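/- Let $H$ be a finite tripartite 3-graph with tripartition $V_1\cup V_2\cup V_3$ (every hyperedge has exactly one vertex in each $V_i$). Let $G=\partial^2H$ be its shadow graph, i.e. the graph on $V(H)$ in which two distinct vertices are adjacent iff some hyperedge contains both, and for $i\ne j$ let $m_{i,j}$ be the number of pairs in $V_i\cup V_j$ contained in at least one hyperedge. For integers $s,t$ and real numbers $n,\delta,K,\ell$ put $$M=\ell^{s-1}n^{s-1+1/s}\left(\ell^{3-2s}K^{s-1}\right)^t ,$$ and define $\phi:2^{V(G)}\to\mathbb R\cup\{\infty\}$ as follows. For $\nu\subseteq V(G)$ let $a=|\nu\cap(V_1\cup V_2)|$ and $b=|\nu\cap V_3|$. If $a=0$ or $b=0$, then $\phi(\nu)=\infty$; otherwise $$\phi(\nu)=\frac{M}{\delta\, m_{i,3}\,(\delta\ell^{-1}Kn^{1-2/s})^{a-1}(\delta\ell^{3-2s}K^{s-1})^{b-1}},$$ where $i=1$ if $\nu\cap V_1\neq\emptyset$ and $i=2$ if $\nu\cap V_1=\emptyset$. A copy of $K_{s,t}$ in $G$ is identified with its edge set. For a collection $\mathcal G$ of copies and $\sigma'\subseteq E(G)$,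 $\deg_{\mathcal G}(\sigma')$ denotes the number of copies in $\mathcal G$ containing $\sigma'$, and $\sigma'_v$ denotes the set of vertices belonging to at least one edge of $\sigma'$. **Proposition 2.2.** There is an absolute constant $C>0$ such that for all integers $s,t\ge 3$ there exists a (sufficiently small) $\delta>0$ for which the following holds. Let $\ell,K,n$ be real numbers with $K>0$ and $n>1$, and let $H$ be a tripartite 3-graph as above such that (a) $|V_i|\le n$ for all $i$; (b) $H$ has at least $Kn^{3-3/s}(12\log n)^{16}$ hyperedges; (c) $m_{i,j}\le \ell|V_1|^{2-1/s}$ for all $i\neq j$; (d) $\delta^{-1}\le\ell\le\delta K^{(s-1)/(2s-3)}$; (e) for all $i\ne j$, each pair in $V_i\cup V_j$ that is contained in at least one hyperedge is contained in at most $Kn^{3-3/s}m_{i,j}^{-1}(12\log n)^{32}$ hyperedges; (f) each vertex in $V_1$ has at most $\ell|V_1|^{1-1/s}(12\log n)^{16}$ neighbors (in $G$) in $V_2$. Then there exists a collection $\mathcal G$ of copies of $K_{s,t}$ in $G$ such that every copy in $\mathcal G$ has its part of size $s$ consisting of $1$ vertex of $V_1$ and $s-1$ vertices of $V_2$ and its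 part of size $t$ contained in $V_3$, such that $$|\mathcal G|\ \ge\ C^{-1}(\log n)^{-C}\,\ell^{s-1}n^{s-1+1/s}\left(\ell^{3-2s}K^{s-1}\right)^t,$$ and such that $\deg_{\mathcal G}(\sigma')\le\phi(\sigma'_v)$ for every $\sigma'\subseteq E(G)$. -/

import Mathlib

open Finset

/-- A tripartite 3-graph on the finite vertex set `V`: a set of 3-element hyperedges, together with
a tripartition `part 0`, `part 1`, `part 2` of `V` (written `V₁, V₂, V₃` in the comments below) such
that every hyperedge has exactly one vertex in each part. -/
structure TripartiteThreeGraph (V : Type*) [Fintype V] [DecidableEq V] where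
  part : Fin 3 → Finset V
  existsUnique_mem_part : ∀ v : V, ∃! i : Fin 3, v ∈ part i
  edges : Finset (Finset V)
  card_of_mem_edges : ∀ h ∈ edges, h.card = 3
  card_inter_part : ∀ h ∈ edges, ∀ i : Fin 3, (h ∩ part i).card = 1

namespace TripartiteThreeGraph

variable {V : Type*} [Fintype V] [DecidableEq V]

/-- The shadow graph `∂²H`: two distinct vertices are adjacent iff some hyperedge contains both. -/
def shadowGraph (H : TripartiteThreeGraph V) : SimpleGraph V where
  Adj u v := u ≠ v ∧ ∃ h ∈ H.edges, u ∈ h ∧ v ∈ h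
  symm := ⟨fun _ _ huv => ⟨huv.1.symm, huv.2.imp fun _ hh => ⟨hh.1, hh.2.2, hh.2.1⟩⟩⟩
  loopless := ⟨fun _ hv => hv.1 rfl⟩

/-- The pairs of vertices in `V_i ∪ V_j` that are contained in at least one hyperedge. -/
def shadowPairs (H : TripartiteThreeGraph V) (i j : Fin 3) : Finset (Finset V) :=
  (Finset.univ : Finset (Finset V)).filter fun e =>
    e.card = 2 ∧ e ⊆ H.part i ∪ H.part j ∧ ∃ h ∈ H.edges, e ⊆ h

/-- The number `m_{i,j}` of pairs in `V_i ∪ V_j` contained in at least one hyperedge. -/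
def m (H : TripartiteThreeGraph V) (i j : Fin 3) : ℕ := (H.shadowPairs i j).card

/-- The number of hyperedges containing the vertex set `e`. -/
def edgeDegree (H : TripartiteThreeGraph V) (e : Finset V) : ℕ :=
  (H.edges.filter fun h => e ⊆ h).card

open Classical in
/-- The number of neighbours of the vertex `v` in `V_j`, in the shadow graph. -/
noncomputable def degreeInto (H : TripartiteThreeGraph V) (v : V) (j : Fin 3) : ℕ :=
  ((H.part j).filter fun w => H.shadowGraph.Adj v w).card

end TripartiteThreeGraph

/-- The quantity `ℓ^{s-1} n^{s-1+1/s} (ℓ^{3-2s} K^{s-1})^t`. -/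
noncomputable def mainCount (s t : ℕ) (n K ℓ : ℝ) : ℝ :=
  ℓ ^ ((s : ℝ) - 1) * n ^ ((s : ℝ) - 1 + 1 / (s : ℝ)) *
    (ℓ ^ (3 - 2 * (s : ℝ)) * K ^ ((s : ℝ) - 1)) ^ t

/-- The function `φ` from sets of vertices to `ℝ ∪ {∞}`. With `a = |ν ∩ (V₁ ∪ V₂)|` and
`b = |ν ∩ V₃|`, it is `∞` if `a = 0` or `b = 0`, and otherwise `mainCount` divided by
`δ m_{i,3} (δ ℓ⁻¹ K n^{1-2/s})^{a-1} (δ ℓ^{3-2s} K^{s-1})^{b-1}`, where `i = 1` if `ν` meets `V₁`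
and `i = 2` if it does not. -/
noncomputable def phi {V : Type*} [Fintype V] [DecidableEq V] (H : TripartiteThreeGraph V)
    (s t : ℕ) (n δ K ℓ : ℝ) (ν : Finset V) : WithTop ℝ :=
  let a : ℕ := (ν ∩ (H.part 0 ∪ H.part 1)).card
  let b : ℕ := (ν ∩ H.part 2).card
  if a = 0 ∨ b = 0 then ⊤
  else
    let mν : ℕ := if (ν ∩ H.part 0).Nonempty then H.m 0 2 else H.m 1 2
    ((mainCount s t n K ℓ /
      (δ * (mν : ℝ) * (δ * ℓ⁻¹ * K * n ^ (1 - 2 / (s : ℝ))) ^ (a - 1) *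
        (δ * ℓ ^ (3 - 2 * (s : ℝ)) * K ^ ((s : ℝ) - 1)) ^ (b - 1)) : ℝ) : WithTop ℝ)

/-- `F` is the edge set of a copy of `K_{s,t}` in the graph `G` with part `S` of size `s` and part
`T` of size `t`. The copy need not be induced. -/
def IsKstCopy {V : Type*} [DecidableEq V] (G : SimpleGraph V) (s t : ℕ) (S T : Finset V)
    (F : Finset (Sym2 V)) : Prop :=
  Disjoint S T ∧ S.card = s ∧ T.card = t ∧ (∀ u ∈ S, ∀ v ∈ T, G.Adj u v) ∧
    F = (S ×ˢ T).image fun p => s(p.1, p.2)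

/-- The set `σ_v` of vertices belonging to at least one edge of `σ`. -/
def edgeVertices {V : Type*} [DecidableEq V] (σ : Finset (Sym2 V)) : Finset V :=
  σ.biUnion Sym2.toFinset

/-- The number of members of the collection `𝒢` (each one a set of edges) that contain `σ`. -/
def collectionDegree {V : Type*} [DecidableEq V] (𝒢 : Finset (Finset (Sym2 V)))
    (σ : Finset (Sym2 V)) : ℕ :=
  (𝒢.filter fun F => σ ⊆ F).card

/-! The proof is a weighted supersaturation count. Write k = s - 1, A = ℓ^{3-2s}K^{s-1}, B =
ℓ⁻¹Kn^{1-2/s}, U = ℓn^{2-1/s}, N = ℓ^{s-1}n^{s-1+1/s} and L = 12 log n. Then M = N A^t, hypothesis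
(b) reads e(H) ≥ U B L^16, and U B^k = N A.

A star is a pair (v, y) in V₁ × V₃ together with k vertices x of V₂ such that every {v, x, y} is a
hyperedge. If (v, X) is the leaf set of t stars with centres T, then {v} ∪ X and T span a K_{s,t} in
the shadow. `exists_dyadic_level` selects pairs (v, y) with links of size at least some d, losing
only powers of L; trimming each link to exactly d vertices gives Z stars. By (f) there are at most N
L^{16k} leaf sets, so a typical one has at least r centres, where r is A up to constants or larger.
Leaf sets with fewer than r centres carry at most half of the stars.

There is no upper bound on the number of centres, so the copies over a leaf set with centre set Y
get weight |Y| / C(|Y|, t): the leaf set then counts once per star, and the total weight is at least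
Z/2. The weighted degree of a vertex set ν with parameters a, b is bounded by fixing one y in ν ∩ V₃
and counting leaf sets: up to constants it is d^{k+1-a} / r^{b-1} if ν meets V₁, and Δ d^{k-a} /
r^{b-1} otherwise, with Δ the codegree bound from (e) for pairs in V₂ ∪ V₃
(`sum_copyWeight_filter_le`). Both are at most q φ(ν) with q = L^33 Z / M.

Finally a maximal subfamily with all degrees at most φ contains at least a constant times (Z/2)/q
copies (`exists_bounded_degree_subfamily`), which is at least M / L^34 once L absorbs the constants.
Degrees are controlled for vertex sets; a copy containing σ contains all its vertices, so edge sets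
are covered. -/

/-! ### Greedy selection and dyadic pigeonholing -/

/-- Take a subfamily of maximal size obeying the degree bounds. Every index left out contains a
saturated key, one whose degree is at least φ/2. The weight left out is thus at most the sum of q φ
over saturated keys, hence at most 2q times the sum of their degrees, and each chosen index adds at
most c to that sum. -/
theorem exists_bounded_degree_subfamily {ι κ : Type*} [DecidableEq ι] [DecidableEq κ]
    (U : Finset ι) (sub : ι → Finset κ) (w : ι → ℝ) (φ : κ → ℝ) (q c : ℝ) (hq : 0 ≤ q)
    (hw : ∀ i ∈ U, 0 ≤ w i) (hc : ∀ i ∈ U, ((sub i).card : ℝ) ≤ c)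
    (hφ : ∀ k ∈ U.biUnion sub, 1 ≤ φ k)
    (hdeg : ∀ k ∈ U.biUnion sub, ∑ i ∈ U.filter (fun i => k ∈ sub i), w i ≤ q * φ k)
    (hwq : ∀ i ∈ U, w i ≤ q) :
    ∃ 𝒢 ⊆ U, (∀ k ∈ U.biUnion sub, ((𝒢.filter fun i => k ∈ sub i).card : ℝ) ≤ φ k) ∧
      ∑ i ∈ U, w i ≤ (2 * c + 1) * q * (𝒢.card : ℝ) := by
  classical
  set S : Finset (Finset ι) := U.powerset.filter fun 𝒢 =>
    ∀ k ∈ U.biUnion sub, ((𝒢.filter fun i => k ∈ sub i).card : ℝ) ≤ φ k with hS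
  have hne : S.Nonempty := by
    refine ⟨∅, ?_⟩
    simp only [hS, mem_filter, mem_powerset, empty_subset, true_and]
    intro k hk
    simpa using le_trans zero_le_one (hφ k hk)
  obtain ⟨𝒢, h𝒢, hmax⟩ := exists_max_image S card hne
  obtain ⟨h𝒢U, h𝒢d⟩ := mem_filter.1 h𝒢
  rw [mem_powerset] at h𝒢U
  refine ⟨𝒢, h𝒢U, h𝒢d, ?_⟩
  set deg : κ → ℕ := fun k => (𝒢.filter fun i => k ∈ sub i).card with hdg
  set T : Finset κ := (U.biUnion sub).filter fun k => φ k ≤ 2 * deg k with hT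
  have key : ∀ i ∈ U, i ∉ 𝒢 → ∃ k ∈ T, k ∈ sub i := by
    intro i hi hi𝒢
    have hnot : insert i 𝒢 ∉ S := by
      intro h
      have := hmax _ h
      rw [card_insert_of_notMem hi𝒢] at this
      omega
    simp only [hS, mem_filter, mem_powerset, insert_subset_iff, hi, h𝒢U, true_and, not_forall,
      not_le] at hnot
    obtain ⟨k, hk, hlt⟩ := hnot
    have hki : k ∈ sub i := by
      by_contra hki
      rw [filter_insert, if_neg hki] at hlt
      exact absurd (h𝒢d k hk) (not_le.2 hlt)
    rw [filter_insert, if_pos hki, card_insert_of_notMem (by simp [hi𝒢])] at hlt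
    refine ⟨k, ?_, hki⟩
    rw [hT, mem_filter]
    refine ⟨hk, ?_⟩
    have h1 := hφ k hk
    have h2 : (0 : ℝ) < deg k := by
      push_cast at hlt
      simp only [hdg]
      linarith
    have h3 : (1 : ℝ) ≤ deg k := by exact_mod_cast Nat.cast_pos.1 h2
    push_cast at hlt
    simp only [hdg] at h3 ⊢
    -- Here φ < deg + 1 and φ ≥ 1; integrality gives deg ≥ 1, hence φ ≤ 2 deg.
    linarith
  have h1 : ∑ i ∈ U \ 𝒢, w i ≤ ∑ k ∈ T, ∑ i ∈ U.filter (fun i => k ∈ sub i), w i := by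
    have hswap : ∑ k ∈ T, ∑ i ∈ U.filter (fun i => k ∈ sub i), w i
        = ∑ i ∈ U, ∑ k ∈ T.filter (fun k => k ∈ sub i), w i := by
      simp only [sum_filter]
      exact sum_comm
    rw [hswap]
    calc ∑ i ∈ U \ 𝒢, w i ≤ ∑ i ∈ U \ 𝒢, ∑ k ∈ T.filter (fun k => k ∈ sub i), w i := by
          refine sum_le_sum fun i hi => ?_
          obtain ⟨hiU, hi𝒢⟩ := mem_sdiff.1 hi
          obtain ⟨k, hk, hki⟩ := key i hiU hi𝒢
          exact single_le_sum (f := fun _ => w i) (fun _ _ => hw i hiU) (mem_filter.2 ⟨hk, hki⟩)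
      _ ≤ _ := sum_le_sum_of_subset_of_nonneg sdiff_subset
          fun i hi _ => sum_nonneg fun _ _ => hw i hi
  have h2 : ∑ k ∈ T, ∑ i ∈ U.filter (fun i => k ∈ sub i), w i ≤ ∑ k ∈ T, q * (2 * deg k) := by
    refine sum_le_sum fun k hk => ?_
    obtain ⟨hkU, hk2⟩ := mem_filter.1 hk
    exact (hdeg k hkU).trans (mul_le_mul_of_nonneg_left hk2 hq)
  have h3 : ∑ k ∈ T, (deg k : ℝ) ≤ c * 𝒢.card := by
    have : ∑ k ∈ T, deg k ≤ ∑ i ∈ 𝒢, (sub i).card := by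
      calc ∑ k ∈ T, deg k = ∑ i ∈ 𝒢, (T.filter fun k => k ∈ sub i).card := by
            simp only [hdg, card_filter]
            exact sum_comm
        _ ≤ _ := sum_le_sum fun i _ => card_le_card fun k hk => (mem_filter.1 hk).2
    calc ∑ k ∈ T, (deg k : ℝ) ≤ ∑ i ∈ 𝒢, ((sub i).card : ℝ) := by exact_mod_cast this
      _ ≤ ∑ i ∈ 𝒢, c := sum_le_sum fun i hi => hc i (h𝒢U hi)
      _ = c * 𝒢.card := by rw [sum_const, nsmul_eq_mul, mul_comm]
  have h4 : ∑ i ∈ 𝒢, w i ≤ q * 𝒢.card := by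
    calc ∑ i ∈ 𝒢, w i ≤ ∑ i ∈ 𝒢, q := sum_le_sum fun i hi => hwq i (h𝒢U hi)
      _ = q * 𝒢.card := by rw [sum_const, nsmul_eq_mul, mul_comm]
  have h5 : ∑ k ∈ T, q * (2 * (deg k : ℝ)) = 2 * q * ∑ k ∈ T, (deg k : ℝ) := by
    rw [mul_sum]
    exact sum_congr rfl fun _ _ => by ring
  have h6 := mul_le_mul_of_nonneg_left h3 (by positivity : 0 ≤ 2 * q)
  rw [← sum_sdiff h𝒢U]
  nlinarith

/-- A set of large total size has a level at which the size is concentrated with only a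
geometrically small loss. -/
theorem exists_dyadic_level {ι : Type*} (P : Finset ι) (f : ι → ℕ) (m h : ℝ) (hm : 0 < m)
    (hh : 0 < h) (hP : (P.card : ℝ) ≤ m) (hf : 2 * m * h ≤ ∑ p ∈ P, (f p : ℝ)) :
    ∃ j : ℕ, (3 / 4 : ℝ) ^ j * m / 8 ≤
      ((P.filter fun p => 2 ^ j * h ≤ (f p : ℝ)).card : ℝ) * 2 ^ j := by
  by_contra! hcon
  obtain ⟨J, hJ⟩ := pow_unbounded_of_one_lt ((∑ p ∈ P, (f p : ℝ)) / h) (one_lt_two : (1 : ℝ) < 2)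
  rw [div_lt_iff₀ hh] at hJ
  -- If f p ≥ h, the largest threshold 2^j h not exceeding f p satisfies f p < 2 · 2^j h, so a
  -- single term of the sum suffices.
  have hpt : ∀ p ∈ P, (f p : ℝ) ≤
      h + ∑ j ∈ range J, if 2 ^ j * h ≤ (f p : ℝ) then 2 * (2 ^ j * h) else 0 := by
    intro p hp
    have hlt : (f p : ℝ) < 2 ^ J * h :=
      lt_of_le_of_lt (single_le_sum (f := fun p => (f p : ℝ)) (fun _ _ => Nat.cast_nonneg _) hp) hJ
    have hind : ∀ J : ℕ, (f p : ℝ) < 2 ^ J * h → (f p : ℝ) ≤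
        h + ∑ j ∈ range J, if 2 ^ j * h ≤ (f p : ℝ) then 2 * (2 ^ j * h) else 0 := by
      intro J
      induction J with
      | zero => intro h0; simpa using h0.le
      | succ J ih =>
        intro h1
        rw [sum_range_succ]
        by_cases hle : 2 ^ J * h ≤ (f p : ℝ)
        · rw [if_pos hle]
          have : 0 ≤ ∑ j ∈ range J, if 2 ^ j * h ≤ (f p : ℝ) then 2 * (2 ^ j * h) else 0 :=
            sum_nonneg fun _ _ => by split_ifs <;> positivity
          rw [pow_succ] at h1
          linarith
        · rw [if_neg hle, add_zero]
          exact ih (not_le.1 hle)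
    exact hind J hlt
  have hsum : ∑ p ∈ P, (f p : ℝ) ≤ P.card * h + ∑ j ∈ range J,
      2 * h * (((P.filter fun p => 2 ^ j * h ≤ (f p : ℝ)).card : ℝ) * 2 ^ j) := by
    refine (sum_le_sum hpt).trans (le_of_eq ?_)
    rw [sum_add_distrib, sum_const, nsmul_eq_mul, sum_comm]
    congr 1
    refine sum_congr rfl fun j _ => ?_
    rw [← sum_filter, sum_const, nsmul_eq_mul]
    ring
  have hgeom : ∑ j ∈ range J, (3 / 4 : ℝ) ^ j < 4 := by
    rw [geom_sum_eq (by norm_num)]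
    have : (0 : ℝ) < (3 / 4) ^ J := by positivity
    norm_num
    linarith
  have hle : ∑ j ∈ range J,
      2 * h * (((P.filter fun p => 2 ^ j * h ≤ (f p : ℝ)).card : ℝ) * 2 ^ j) ≤
      2 * h * (m / 8) * ∑ j ∈ range J, (3 / 4 : ℝ) ^ j := by
    rw [mul_sum]
    refine sum_le_sum fun j _ => ?_
    have := mul_le_mul_of_nonneg_left (hcon j).le (by positivity : 0 ≤ 2 * h)
    linarith
  -- The geometric sum is below 4, so the levels contribute less than mh; with the mh from small
  -- values this contradicts the total 2mh.
  have h1 := mul_lt_mul_of_pos_left hgeom (by positivity : 0 < 2 * h * (m / 8))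
  have h2 := mul_le_mul_of_nonneg_right hP hh.le
  linarith

/-! ### Binomial estimates -/

theorem pow_le_mul_choose (n k : ℕ) (hk : k ≤ n) :
    n ^ k ≤ k ^ k * k.factorial * n.choose k := by
  rcases Nat.eq_zero_or_pos k with rfl | hk0
  · simp
  have h1 : n ≤ k * (n + 1 - k) := by
    obtain ⟨a, rfl⟩ := Nat.exists_eq_add_of_le hk
    have : k + a + 1 - k = a + 1 := by omega
    rw [this]
    nlinarith
  calc n ^ k ≤ (k * (n + 1 - k)) ^ k := Nat.pow_le_pow_left h1 k
    _ = k ^ k * (n + 1 - k) ^ k := mul_pow _ _ _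
    _ ≤ k ^ k * n.descFactorial k := Nat.mul_le_mul_left _ (Nat.pow_sub_le_descFactorial n k)
    _ = k ^ k * k.factorial * n.choose k := by
      rw [Nat.descFactorial_eq_factorial_mul_choose, mul_assoc]

/-- Among the `t`-subsets of `Y`, the proportion containing a fixed set of size `b ≥ 1`. -/
theorem card_div_choose_mul_le {γ : Type*} [DecidableEq γ] (Y Y' : Finset γ) (t : ℕ) (r : ℝ)
    (hr : 0 < r) (hrY : r ≤ (Y.card : ℝ)) (htY : t ≤ Y.card) (hY' : 1 ≤ Y'.card)
    (hY't : Y'.card ≤ t) :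
    ((Y.card : ℝ) / (Y.card.choose t : ℝ)) *
      (((powersetCard t Y).filter fun T => Y' ⊆ T).card : ℝ) ≤
      2 ^ t * (t ^ t * t.factorial : ℝ) / r ^ (Y'.card - 1) := by
  set b := Y'.card with hb
  set y := Y.card with hy
  have hchoose : (0 : ℝ) < (y.choose t : ℝ) := by exact_mod_cast Nat.choose_pos htY
  by_cases hsub : Y' ⊆ Y
  swap
  · have : (powersetCard t Y).filter (fun T => Y' ⊆ T) = ∅ := by
      rw [filter_eq_empty_iff]
      intro T hT hYT
      exact hsub (hYT.trans (mem_powersetCard.1 hT).1)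
    rw [this]
    simp only [card_empty, Nat.cast_zero, mul_zero]
    positivity
  have hcount : ((powersetCard t Y).filter fun T => Y' ⊆ T).card ≤ (y - b).choose (t - b) :=
    (card_filter_powersetCard_subset Y' Y t hsub hY't).le
  have hmul : y.choose t * t.choose b = y.choose b * (y - b).choose (t - b) :=
    Nat.choose_mul hY't
  have hpow : (y : ℝ) ^ b ≤ (b ^ b * b.factorial : ℝ) * y.choose b := by
    exact_mod_cast pow_le_mul_choose y b (hY't.trans htY)
  have hbt : (b ^ b * b.factorial : ℝ) ≤ t ^ t * t.factorial := by
    have h1 : b ^ b ≤ t ^ t := (Nat.pow_le_pow_left hY't b).trans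
      (Nat.pow_le_pow_right (hY'.trans hY't) hY't)
    have h2 : b.factorial ≤ t.factorial := Nat.factorial_le hY't
    exact_mod_cast Nat.mul_le_mul h1 h2
  have h2t : (t.choose b : ℝ) ≤ 2 ^ t := by
    exact_mod_cast Nat.choose_le_two_pow t b
  have hy0 : (0 : ℝ) < y := hr.trans_le hrY
  have hcb : (0 : ℝ) < (y.choose b : ℝ) := by exact_mod_cast Nat.choose_pos (hY't.trans htY)
  have hrpow : r ^ (b - 1) ≤ (y : ℝ) ^ (b - 1) := pow_le_pow_left₀ hr.le hrY _
  have hyb : (y : ℝ) * (y : ℝ) ^ (b - 1) = (y : ℝ) ^ b := by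
    rw [← pow_succ']
    congr 1
    omega
  have hmulR : (y.choose t : ℝ) * t.choose b = y.choose b * ((y - b).choose (t - b) : ℕ) := by
    exact_mod_cast hmul
  have hcountR : (((powersetCard t Y).filter fun T => Y' ⊆ T).card : ℝ) ≤
      ((y - b).choose (t - b) : ℕ) := by exact_mod_cast hcount
  rw [le_div_iff₀ (by positivity), div_mul_eq_mul_div, div_mul_eq_mul_div, div_le_iff₀ hchoose]
  -- After multiplying by C(y, b), the identity C(y, t) C(t, b) = C(y, b) C(y-b, t-b) turns the
  -- proportion into C(t, b) / C(y, b), of order y^{-b}; the extra factor y leaves y^{1-b} ≤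
  -- r^{1-b}.
  refine le_of_mul_le_mul_left ?_ hcb
  calc (y.choose b : ℝ) * ((y : ℝ) * (((powersetCard t Y).filter fun T => Y' ⊆ T).card : ℝ) *
        r ^ (b - 1))
      ≤ (y.choose b : ℝ) * ((y : ℝ) * ((y - b).choose (t - b) : ℕ) * (y : ℝ) ^ (b - 1)) := by
        gcongr
    _ = (y : ℝ) ^ b * (y.choose t : ℝ) * t.choose b := by
        rw [mul_assoc _ (y.choose t : ℝ), hmulR, ← hyb]; ring
    _ ≤ ((t ^ t * t.factorial : ℝ) * y.choose b) * (y.choose t : ℝ) * 2 ^ t := by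
        have := hpow.trans (mul_le_mul_of_nonneg_right hbt hcb.le)
        gcongr
    _ = _ := by ring

/-! ### Counting stars and weighted copies -/

section Stars

variable {α β γ : Type*} [DecidableEq α] [DecidableEq β]

/-- The leaf sets of stars, consisting of one vertex `v` and a `k`-set `X`. -/
def starLeaves (P : Finset (α × γ)) (D : α → γ → Finset β) (k : ℕ) : Finset (α × Finset β) :=
  P.biUnion fun p => (powersetCard k (D p.1 p.2)).image (Prod.mk p.1)

theorem mem_starLeaves {P : Finset (α × γ)} {D : α → γ → Finset β} {k : ℕ} {z : α × Finset β} :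
    z ∈ starLeaves P D k ↔ ∃ y, (z.1, y) ∈ P ∧ z.2 ⊆ D z.1 y ∧ z.2.card = k := by
  obtain ⟨v, X⟩ := z
  simp only [starLeaves, mem_biUnion, mem_image, mem_powersetCard, Prod.mk.injEq, Prod.exists]
  constructor
  · rintro ⟨a, y, hP, X', hX', rfl, rfl⟩
    exact ⟨y, hP, hX'⟩
  · rintro ⟨y, hP, hX⟩
    exact ⟨v, y, hP, X, hX, rfl, rfl⟩

variable [DecidableEq γ] [Fintype γ]

/-- The centres `y` of the stars with leaves `v` and `X`. -/
def starCentres (P : Finset (α × γ)) (D : α → γ → Finset β) (z : α × Finset β) : Finset γ :=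
  univ.filter fun y => (z.1, y) ∈ P ∧ z.2 ⊆ D z.1 y

theorem sum_card_starCentres (P : Finset (α × γ)) (D : α → γ → Finset β) (k d : ℕ)
    (hD : ∀ p ∈ P, (D p.1 p.2).card = d) :
    ∑ z ∈ starLeaves P D k, (starCentres P D z).card = P.card * d.choose k := by
  have h1 : ∀ z, (starCentres P D z).card = (P.filter fun p => z.1 = p.1 ∧ z.2 ⊆ D p.1 p.2).card := by
    intro z
    refine card_bij (fun y _ => (z.1, y)) ?_ ?_ ?_
    · intro y hy
      simpa [starCentres] using hy
    · intro y _ y' _ h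
      exact (Prod.mk.inj h).2
    · rintro ⟨v, y⟩ h
      simp only [mem_filter] at h
      obtain ⟨h1, h2, h3⟩ := h
      subst h2
      exact ⟨y, by simp [starCentres, h1, h3], rfl⟩
  simp only [h1, card_filter]
  rw [sum_comm, card_eq_sum_ones, sum_mul]
  refine sum_congr rfl fun p hp => ?_
  rw [← card_filter, one_mul, ← hD p hp, ← card_powersetCard]
  refine card_bij (fun z _ => z.2) ?_ ?_ ?_
  · intro z hz
    obtain ⟨hz1, hz2, hz3⟩ := mem_filter.1 hz
    obtain ⟨y, _, _, hc⟩ := mem_starLeaves.1 hz1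
    exact mem_powersetCard.2 ⟨hz3, hc⟩
  · intro z hz z' hz' h
    exact Prod.ext ((mem_filter.1 hz).2.1.trans (mem_filter.1 hz').2.1.symm) h
  · intro X hX
    obtain ⟨hX1, hX2⟩ := mem_powersetCard.1 hX
    exact ⟨(p.1, X), mem_filter.2 ⟨mem_starLeaves.2 ⟨p.2, hp, hX1, hX2⟩, rfl, hX1⟩, rfl⟩

/-- The copies `(v, X, T)` of `K_{k+1,t}` formed by the stars whose leaf set has at least `r`
centres. -/
noncomputable def richCopies (P : Finset (α × γ)) (D : α → γ → Finset β) (k t : ℕ) (r : ℝ) :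
    Finset (Σ _ : α × Finset β, Finset γ) :=
  ((starLeaves P D k).filter fun z => r ≤ ((starCentres P D z).card : ℝ)).sigma
    fun z => powersetCard t (starCentres P D z)

/-- The weight of a copy; the copies over a given leaf set have total weight equal to the number of
centres. -/
noncomputable def copyWeight (P : Finset (α × γ)) (D : α → γ → Finset β) (t : ℕ)
    (i : Σ _ : α × Finset β, Finset γ) : ℝ :=
  ((starCentres P D i.1).card : ℝ) / ((starCentres P D i.1).card.choose t : ℝ)

theorem mem_richCopies {P : Finset (α × γ)} {D : α → γ → Finset β} {k t : ℕ} {r : ℝ}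
    {i : Σ _ : α × Finset β, Finset γ} :
    i ∈ richCopies P D k t r ↔ (i.1 ∈ starLeaves P D k ∧ r ≤ ((starCentres P D i.1).card : ℝ)) ∧
      i.2 ⊆ starCentres P D i.1 ∧ i.2.card = t := by
  simp only [richCopies, mem_sigma, mem_filter, mem_powersetCard]

theorem copyWeight_nonneg (P : Finset (α × γ)) (D : α → γ → Finset β) (t : ℕ)
    (i : Σ _ : α × Finset β, Finset γ) : 0 ≤ copyWeight P D t i := by
  unfold copyWeight
  positivity

/-- Leaf sets with fewer than r centres account for at most q r stars, which is at most half of all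
stars. Over each remaining leaf set the weights sum to its number of centres. -/
theorem half_le_sum_copyWeight (P : Finset (α × γ)) (D : α → γ → Finset β) (k t d : ℕ)
    (hD : ∀ p ∈ P, (D p.1 p.2).card = d) (q r : ℝ)
    (hq : ((starLeaves P D k).card : ℝ) ≤ q) (hr0 : 0 ≤ r)
    (hr : 2 * q * r ≤ (P.card : ℝ) * d.choose k) (hrt : (t : ℝ) ≤ r) :
    (P.card : ℝ) * d.choose k / 2 ≤ ∑ i ∈ richCopies P D k t r, copyWeight P D t i := by
  classical
  have hsum : ∑ i ∈ richCopies P D k t r, copyWeight P D t i =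
      ∑ z ∈ (starLeaves P D k).filter (fun z => r ≤ ((starCentres P D z).card : ℝ)),
        ((starCentres P D z).card : ℝ) := by
    unfold richCopies
    rw [sum_sigma]
    refine sum_congr rfl fun z hz => ?_
    have hz := hrt.trans (mem_filter.1 hz).2
    have hz : t ≤ (starCentres P D z).card := by exact_mod_cast hz
    have hpos : (0 : ℝ) < ((starCentres P D z).card.choose t : ℝ) := by
      exact_mod_cast Nat.choose_pos hz
    simp only [copyWeight, sum_const, card_powersetCard, nsmul_eq_mul]
    field_simp
  have htot : ∑ z ∈ starLeaves P D k, ((starCentres P D z).card : ℝ) =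
      (P.card : ℝ) * d.choose k := by
    exact_mod_cast sum_card_starCentres P D k d hD
  have hpoor : ∑ z ∈ (starLeaves P D k).filter
      (fun z => ¬ r ≤ ((starCentres P D z).card : ℝ)), ((starCentres P D z).card : ℝ) ≤ q * r := by
    calc _ ≤ ∑ z ∈ (starLeaves P D k).filter
          (fun z => ¬ r ≤ ((starCentres P D z).card : ℝ)), r :=
          sum_le_sum fun z hz => (not_le.1 (mem_filter.1 hz).2).le
      _ ≤ ∑ z ∈ starLeaves P D k, r :=
          sum_le_sum_of_subset_of_nonneg (filter_subset _ _) fun _ _ _ => hr0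
      _ = (starLeaves P D k).card * r := by rw [sum_const, nsmul_eq_mul]
      _ ≤ q * r := mul_le_mul_of_nonneg_right hq hr0
  rw [hsum]
  rw [← sum_filter_add_sum_filter_not (starLeaves P D k)
    (fun z => r ≤ ((starCentres P D z).card : ℝ))] at htot
  linarith

/-- Once v and the centre y are fixed, the k - |X'| leaves outside X' lie in a trimmed link of size
d. -/
theorem card_filter_starLeaves_le (P : Finset (α × γ)) (D : α → γ → Finset β) (k d : ℕ)
    (hD : ∀ p ∈ P, (D p.1 p.2).card = d) (S : Finset α) (X' : Finset β) (y : γ) :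
    ((starLeaves P D k).filter fun z => z.1 ∈ S ∧ X' ⊆ z.2 ∧ y ∈ starCentres P D z).card ≤
      S.card * d ^ (k - X'.card) := by
  classical
  have hsub : ((starLeaves P D k).filter fun z => z.1 ∈ S ∧ X' ⊆ z.2 ∧ y ∈ starCentres P D z) ⊆
      S.biUnion fun v => ((starLeaves P D k).filter fun z =>
        z.1 = v ∧ X' ⊆ z.2 ∧ y ∈ starCentres P D z) := by
    intro z hz
    obtain ⟨h1, h2, h3⟩ := mem_filter.1 hz
    exact mem_biUnion.2 ⟨z.1, h2, mem_filter.2 ⟨h1, rfl, h3⟩⟩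
  refine (card_le_card hsub).trans (card_biUnion_le_card_mul _ _ _ fun v _ => ?_)
  by_cases hv : (v, y) ∈ P
  swap
  · rw [card_eq_zero.2]
    · exact Nat.zero_le _
    rw [filter_eq_empty_iff]
    rintro z hz ⟨rfl, _, hy⟩
    exact hv (mem_filter.1 hy).2.1
  calc _ ≤ (powersetCard (k - X'.card) (D v y)).card := by
        refine card_le_card_of_injOn (fun z => z.2 \ X') ?_ ?_
        · intro z hz
          obtain ⟨hz1, rfl, hz3, hy⟩ := mem_filter.1 (mem_coe.1 hz)
          obtain ⟨_, _, _, hc⟩ := mem_starLeaves.1 hz1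
          refine mem_coe.2 (mem_powersetCard.2 ⟨sdiff_subset.trans (mem_filter.1 hy).2.2, ?_⟩)
          rw [card_sdiff_of_subset hz3, hc]
        · intro z hz z' hz' h
          obtain ⟨_, h2, h3, _⟩ := mem_filter.1 (mem_coe.1 hz)
          obtain ⟨_, h2', h3', _⟩ := mem_filter.1 (mem_coe.1 hz')
          have h : z.2 \ X' = z'.2 \ X' := h
          refine Prod.ext (h2.trans h2'.symm) ?_
          rw [← sdiff_union_of_subset h3, h, sdiff_union_of_subset h3']
    _ = d.choose (k - X'.card) := by rw [card_powersetCard, hD _ hv]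
    _ ≤ d ^ (k - X'.card) := Nat.choose_le_pow _ _

/-- One vertex y of Y' restricts the leaf sets to those having y as a centre. Over each such leaf
set, the copies with Y' ⊆ T have total weight O(r^{1-|Y'|}), so the remaining |Y'| - 1 vertices of
Y' each save a factor r. -/
theorem sum_copyWeight_filter_le (P : Finset (α × γ)) (D : α → γ → Finset β) (k t d : ℕ)
    (hD : ∀ p ∈ P, (D p.1 p.2).card = d) (r : ℝ) (hr0 : 0 < r) (hrt : (t : ℝ) ≤ r)
    (S : Finset α) (X' : Finset β) (Y' : Finset γ) (hY' : 1 ≤ Y'.card) (hY't : Y'.card ≤ t) :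
    ∑ i ∈ (richCopies P D k t r).filter (fun i => i.1.1 ∈ S ∧ X' ⊆ i.1.2 ∧ Y' ⊆ i.2),
      copyWeight P D t i ≤
      2 ^ t * (t ^ t * t.factorial : ℝ) / r ^ (Y'.card - 1) *
        ((S.card : ℝ) * (d : ℝ) ^ (k - X'.card)) := by
  classical
  obtain ⟨y, hy⟩ := card_pos.1 hY'
  set Q := (starLeaves P D k).filter fun z => r ≤ ((starCentres P D z).card : ℝ) with hQ
  set Q' := (starLeaves P D k).filter fun z => z.1 ∈ S ∧ X' ⊆ z.2 ∧ y ∈ starCentres P D z with hQ'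
  set c := 2 ^ t * (t ^ t * t.factorial : ℝ) / r ^ (Y'.card - 1) with hc
  have hc0 : 0 ≤ c := by positivity
  have hle : (richCopies P D k t r).filter (fun i => i.1.1 ∈ S ∧ X' ⊆ i.1.2 ∧ Y' ⊆ i.2) ⊆
      (Q ∩ Q').sigma fun z => (powersetCard t (starCentres P D z)).filter fun T => Y' ⊆ T := by
    intro i hi
    obtain ⟨hi1, hi2, hi3, hi4⟩ := mem_filter.1 hi
    obtain ⟨⟨h1, h2⟩, h3, h4⟩ := mem_richCopies.1 hi1
    refine mem_sigma.2 ⟨mem_inter.2 ⟨mem_filter.2 ⟨h1, h2⟩, mem_filter.2 ⟨h1, hi2, hi3, ?_⟩⟩,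
      mem_filter.2 ⟨mem_powersetCard.2 ⟨h3, h4⟩, hi4⟩⟩
    exact h3 (hi4 hy)
  calc _ ≤ ∑ i ∈ (Q ∩ Q').sigma fun z =>
        (powersetCard t (starCentres P D z)).filter fun T => Y' ⊆ T, copyWeight P D t i :=
        sum_le_sum_of_subset_of_nonneg hle fun i _ _ => copyWeight_nonneg P D t i
    _ = ∑ z ∈ Q ∩ Q', ((starCentres P D z).card : ℝ) / ((starCentres P D z).card.choose t : ℝ) *
        (((powersetCard t (starCentres P D z)).filter fun T => Y' ⊆ T).card : ℝ) := by
        rw [sum_sigma]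
        refine sum_congr rfl fun z _ => ?_
        simp only [copyWeight, sum_const, nsmul_eq_mul]
        ring
    _ ≤ ∑ z ∈ Q ∩ Q', c := by
        refine sum_le_sum fun z hz => ?_
        have hz := (mem_filter.1 (mem_inter.1 hz).1).2
        exact card_div_choose_mul_le _ _ _ _ hr0 hz (by exact_mod_cast hrt.trans hz) hY' hY't
    _ = (Q ∩ Q').card * c := by rw [sum_const, nsmul_eq_mul]
    _ ≤ ((S.card : ℝ) * (d : ℝ) ^ (k - X'.card)) * c := by
        refine mul_le_mul_of_nonneg_right ?_ hc0
        exact_mod_cast (card_le_card inter_subset_right).trans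
          (card_filter_starLeaves_le P D k d hD S X' y)
    _ = _ := mul_comm _ _

end Stars

/-! ### Links and shadow pairs of the 3-graph -/

namespace TripartiteThreeGraph

variable {V : Type*} [Fintype V] [DecidableEq V] (H : TripartiteThreeGraph V)

theorem eq_of_mem_part {v : V} {i j : Fin 3} (hi : v ∈ H.part i) (hj : v ∈ H.part j) : i = j :=
  (H.existsUnique_mem_part v).unique hi hj

theorem disjoint_part {i j : Fin 3} (hij : i ≠ j) : Disjoint (H.part i) (H.part j) :=
  disjoint_left.2 fun _ hi hj => hij (H.eq_of_mem_part hi hj)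

theorem ne_of_mem_part {u v : V} {i j : Fin 3} (hij : i ≠ j) (hu : u ∈ H.part i)
    (hv : v ∈ H.part j) : u ≠ v := by
  rintro rfl
  exact hij (H.eq_of_mem_part hu hv)

/-- The vertices `x ∈ V₂` forming a hyperedge with `v` and `y`. -/
def middleLink (v y : V) : Finset V := (H.part 1).filter fun x => {v, x, y} ∈ H.edges

/-- The vertices `v ∈ V₁` forming a hyperedge with `x` and `y`. -/
def firstLink (x y : V) : Finset V := (H.part 0).filter fun v => {v, x, y} ∈ H.edges

/-- The pairs in `V₁ × V₃` contained in a hyperedge. -/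
def outerPairs : Finset (V × V) :=
  (H.part 0 ×ˢ H.part 2).filter fun p => (H.middleLink p.1 p.2).Nonempty

theorem exists_eq_triple {e : Finset V} (he : e ∈ H.edges) :
    ∃ v ∈ H.part 0, ∃ x ∈ H.part 1, ∃ y ∈ H.part 2, e = {v, x, y} := by
  obtain ⟨v, hv⟩ := card_eq_one.1 (H.card_inter_part e he 0)
  obtain ⟨x, hx⟩ := card_eq_one.1 (H.card_inter_part e he 1)
  obtain ⟨y, hy⟩ := card_eq_one.1 (H.card_inter_part e he 2)
  obtain ⟨hv1, hv2⟩ := mem_inter.1 (hv.symm ▸ mem_singleton_self v)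
  obtain ⟨hx1, hx2⟩ := mem_inter.1 (hx.symm ▸ mem_singleton_self x)
  obtain ⟨hy1, hy2⟩ := mem_inter.1 (hy.symm ▸ mem_singleton_self y)
  refine ⟨v, hv2, x, hx2, y, hy2, (eq_of_subset_of_card_le ?_ ?_).symm⟩
  · simp [insert_subset_iff, hv1, hx1, hy1]
  · rw [H.card_of_mem_edges e he, card_eq_three.2]
    exact ⟨v, x, y, H.ne_of_mem_part (by decide) hv2 hx2, H.ne_of_mem_part (by decide) hv2 hy2,
      H.ne_of_mem_part (by decide) hx2 hy2, rfl⟩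

theorem card_edges_le : H.edges.card ≤ ∑ p ∈ H.outerPairs, (H.middleLink p.1 p.2).card := by
  rw [← card_sigma]
  refine card_le_card_of_surjOn
    (fun z : (Σ _ : V × V, V) => ({z.1.1, z.2, z.1.2} : Finset V)) ?_
  intro e he
  obtain ⟨v, hv, x, hx, y, hy, rfl⟩ := H.exists_eq_triple (mem_coe.1 he)
  have hmem : x ∈ H.middleLink v y := mem_filter.2 ⟨hx, mem_coe.1 he⟩
  exact ⟨⟨(v, y), x⟩, mem_coe.2 (mem_sigma.2 ⟨mem_filter.2 ⟨mem_product.2 ⟨hv, hy⟩, x, hmem⟩,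
    hmem⟩), rfl⟩

theorem pair_mem_shadowPairs {u w : V} {i j : Fin 3} (hij : i ≠ j) (hu : u ∈ H.part i)
    (hw : w ∈ H.part j) {e : Finset V} (he : e ∈ H.edges) (hue : u ∈ e) (hwe : w ∈ e) :
    {u, w} ∈ H.shadowPairs i j := by
  simp only [shadowPairs, mem_filter, mem_univ, true_and]
  refine ⟨card_pair (H.ne_of_mem_part hij hu hw), ?_, e, he, ?_⟩
  · simp [insert_subset_iff, hu, hw]
  · simp [insert_subset_iff, hue, hwe]

theorem pair_mem_shadowPairs_of_mem_outerPairs {p : V × V} (hp : p ∈ H.outerPairs) :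
    {p.1, p.2} ∈ H.shadowPairs 0 2 := by
  obtain ⟨hp1, x, hx⟩ := mem_filter.1 hp
  obtain ⟨h1, h2⟩ := mem_product.1 hp1
  exact H.pair_mem_shadowPairs (by decide) h1 h2 (mem_filter.1 hx).2 (by simp) (by simp)

theorem card_outerPairs_le : H.outerPairs.card ≤ H.m 0 2 := by
  refine card_le_card_of_injOn (fun p => {p.1, p.2})
    (fun p hp => H.pair_mem_shadowPairs_of_mem_outerPairs hp) ?_
  intro p hp p' hp' h
  obtain ⟨h1, h2⟩ := mem_product.1 (mem_filter.1 (mem_coe.1 hp)).1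
  obtain ⟨h1', h2'⟩ := mem_product.1 (mem_filter.1 (mem_coe.1 hp')).1
  have h : ({p.1, p.2} : Finset V) = {p'.1, p'.2} := h
  have e1 : p.1 ∈ ({p'.1, p'.2} : Finset V) := h ▸ mem_insert_self _ _
  have e2 : p.2 ∈ ({p'.1, p'.2} : Finset V) := h ▸ mem_insert_of_mem (mem_singleton_self _)
  rw [mem_insert, mem_singleton] at e1 e2
  exact Prod.ext (e1.resolve_right (H.ne_of_mem_part (by decide) h1 h2'))
    (e2.resolve_left (H.ne_of_mem_part (by decide) h2 h1'))

theorem card_middleLink_le {v y : V} (hv : v ∈ H.part 0) (hy : y ∈ H.part 2) :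
    (H.middleLink v y).card ≤ H.edgeDegree {v, y} := by
  refine card_le_card_of_injOn (fun x => {v, x, y}) ?_ ?_
  · intro x hx
    refine mem_coe.2 (mem_filter.2 ⟨(mem_filter.1 (mem_coe.1 hx)).2, ?_⟩)
    simp [insert_subset_iff]
  · intro x hx x' hx' h
    have hx := (mem_filter.1 (mem_coe.1 hx)).1
    have h : ({v, x, y} : Finset V) = {v, x', y} := h
    have e : x ∈ ({v, x', y} : Finset V) := h ▸ (by simp)
    simp only [mem_insert, mem_singleton] at e
    exact (e.resolve_left (H.ne_of_mem_part (by decide) hx hv)).resolve_right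
      (H.ne_of_mem_part (by decide) hx hy)

theorem card_firstLink_le {x y : V} (hx : x ∈ H.part 1) (hy : y ∈ H.part 2) :
    (H.firstLink x y).card ≤ H.edgeDegree {x, y} := by
  refine card_le_card_of_injOn (fun v => {v, x, y}) ?_ ?_
  · intro v hv
    refine mem_coe.2 (mem_filter.2 ⟨(mem_filter.1 (mem_coe.1 hv)).2, ?_⟩)
    simp
  · intro v hv v' hv' h
    have hv := (mem_filter.1 (mem_coe.1 hv)).1
    have h : ({v, x, y} : Finset V) = {v', x, y} := h
    have e : v ∈ ({v', x, y} : Finset V) := h ▸ (by simp)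
    simp only [mem_insert, mem_singleton] at e
    exact (e.resolve_right (not_or.2 ⟨H.ne_of_mem_part (by decide) hv hx,
      H.ne_of_mem_part (by decide) hv hy⟩))

/-- The leaves in V₂ are all shadow neighbours of v, so the degree bound Λ limits the choices of X.
-/
theorem card_starLeaves_le (P : Finset (V × V)) (D : V → V → Finset V) (k : ℕ)
    (hP : ∀ p ∈ P, p.1 ∈ H.part 0 ∧ p.2 ∈ H.part 2)
    (hD : ∀ p ∈ P, D p.1 p.2 ⊆ H.middleLink p.1 p.2) (Λ : ℝ)
    (hΛ : ∀ v ∈ H.part 0, (H.degreeInto v 1 : ℝ) ≤ Λ) :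
    ((starLeaves P D k).card : ℝ) ≤ (H.part 0).card * Λ ^ k := by
  classical
  have hsub : starLeaves P D k ⊆ (H.part 0).biUnion fun v =>
      (powersetCard k ((H.part 1).filter fun w => H.shadowGraph.Adj v w)).image (Prod.mk v) := by
    intro z hz
    obtain ⟨y, hy, hzD, hzk⟩ := mem_starLeaves.1 hz
    refine mem_biUnion.2 ⟨z.1, (hP _ hy).1, mem_image.2 ⟨z.2, mem_powersetCard.2 ⟨?_, hzk⟩, rfl⟩⟩
    intro x hx
    obtain ⟨hx1, hx2⟩ := mem_filter.1 (hD _ hy (hzD hx))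
    exact mem_filter.2 ⟨hx1, H.ne_of_mem_part (by decide) (hP _ hy).1 hx1, _, hx2, by simp, by simp⟩
  calc ((starLeaves P D k).card : ℝ) ≤ ∑ v ∈ H.part 0, ((H.degreeInto v 1 : ℝ)) ^ k := by
        have : (starLeaves P D k).card ≤ ∑ v ∈ H.part 0, (H.degreeInto v 1) ^ k := by
          refine (card_le_card hsub).trans (card_biUnion_le.trans (sum_le_sum fun v _ => ?_))
          refine card_image_le.trans ?_
          rw [card_powersetCard]
          refine (Nat.choose_le_pow _ _).trans (le_of_eq ?_)
          unfold degreeInto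
          congr!
        exact_mod_cast this
    _ ≤ ∑ v ∈ H.part 0, Λ ^ k :=
        sum_le_sum fun v hv => pow_le_pow_left₀ (Nat.cast_nonneg _) (hΛ v hv) k
    _ = _ := by rw [sum_const, nsmul_eq_mul]

end TripartiteThreeGraph

/-! ### From weighted triples to a collection of copies -/

/-- The set of edges between the parts of a copy of `K_{s,t}`. -/
def copyEdges {V : Type*} [DecidableEq V] (i : Σ _ : V × Finset V, Finset V) :
    Finset (Sym2 V) :=
  ((insert i.1.1 i.1.2) ×ˢ i.2).image fun p => s(p.1, p.2)

/-- The vertex set of a copy of `K_{s,t}`. -/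
def copyVertices {V : Type*} [DecidableEq V] (i : Σ _ : V × Finset V, Finset V) : Finset V :=
  insert i.1.1 i.1.2 ∪ i.2

theorem edgeVertices_mono {V : Type*} [DecidableEq V] {σ τ : Finset (Sym2 V)} (h : σ ⊆ τ) :
    edgeVertices σ ⊆ edgeVertices τ :=
  biUnion_subset_biUnion_of_subset_left _ h

theorem edgeVertices_copyEdges {V : Type*} [DecidableEq V] (i : Σ _ : V × Finset V, Finset V)
    (hi : i.2.Nonempty) : edgeVertices (copyEdges i) = copyVertices i := by
  obtain ⟨y, hy⟩ := hi
  ext w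
  simp only [edgeVertices, copyEdges, copyVertices, mem_biUnion, mem_image, mem_product,
    Prod.exists, Sym2.mem_toFinset, mem_union]
  constructor
  · rintro ⟨e, ⟨a, b, ⟨ha, hb⟩, rfl⟩, hw⟩
    rcases Sym2.mem_iff.1 hw with rfl | rfl
    · exact Or.inl ha
    · exact Or.inr hb
  · rintro (hw | hw)
    · exact ⟨_, ⟨w, y, ⟨hw, hy⟩, rfl⟩, Sym2.mem_mk_left _ _⟩
    · exact ⟨_, ⟨i.1.1, w, ⟨mem_insert_self _ _, hw⟩, rfl⟩, Sym2.mem_mk_right _ _⟩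

namespace TripartiteThreeGraph

variable {V : Type*} [Fintype V] [DecidableEq V] (H : TripartiteThreeGraph V)

theorem mem_parts_of_mem_richCopies {P : Finset (V × V)} {D : V → V → Finset V} {k t : ℕ} {r : ℝ}
    (hP : ∀ p ∈ P, p.1 ∈ H.part 0 ∧ p.2 ∈ H.part 2)
    (hD : ∀ p ∈ P, D p.1 p.2 ⊆ H.middleLink p.1 p.2)
    {i : Σ _ : V × Finset V, Finset V} (hi : i ∈ richCopies P D k t r) :
    i.1.1 ∈ H.part 0 ∧ i.1.2 ⊆ H.part 1 ∧ i.2 ⊆ H.part 2 ∧ i.1.2.card = k ∧ i.2.card = t ∧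
      ∀ y ∈ i.2, i.1.2 ⊆ H.middleLink i.1.1 y := by
  obtain ⟨⟨h1, _⟩, h3, h4⟩ := mem_richCopies.1 hi
  obtain ⟨y, hy, hyD, hk⟩ := mem_starLeaves.1 h1
  refine ⟨(hP _ hy).1, hyD.trans ((hD _ hy).trans (filter_subset _ _)), ?_, hk, h4, ?_⟩
  · intro y hy
    exact (hP _ (mem_filter.1 (h3 hy)).2.1).2
  · intro y hy
    exact (mem_filter.1 (h3 hy)).2.2.trans (hD _ (mem_filter.1 (h3 hy)).2.1)

theorem copyVertices_inter_part {i : Σ _ : V × Finset V, Finset V} (h0 : i.1.1 ∈ H.part 0)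
    (h1 : i.1.2 ⊆ H.part 1) (h2 : i.2 ⊆ H.part 2) :
    copyVertices i ∩ H.part 0 = {i.1.1} ∧ copyVertices i ∩ H.part 1 = i.1.2 ∧
      copyVertices i ∩ H.part 2 = i.2 := by
  have key : ∀ w : V, w ∈ copyVertices i ↔ w = i.1.1 ∨ w ∈ i.1.2 ∨ w ∈ i.2 := by
    intro w
    simp only [copyVertices, mem_union, mem_insert, or_assoc]
  refine ⟨?_, ?_, ?_⟩
  · ext w
    simp only [mem_inter, key, mem_singleton]
    constructor
    · rintro ⟨rfl | h | h, hw⟩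
      · rfl
      · exact absurd (H.eq_of_mem_part (h1 h) hw) (by decide)
      · exact absurd (H.eq_of_mem_part (h2 h) hw) (by decide)
    · rintro rfl
      exact ⟨Or.inl rfl, h0⟩
  · ext w
    simp only [mem_inter, key]
    constructor
    · rintro ⟨rfl | h | h, hw⟩
      · exact absurd (H.eq_of_mem_part h0 hw) (by decide)
      · exact h
      · exact absurd (H.eq_of_mem_part (h2 h) hw) (by decide)
    · exact fun h => ⟨Or.inr (Or.inl h), h1 h⟩
  · ext w
    simp only [mem_inter, key]
    constructor
    · rintro ⟨rfl | h | h, hw⟩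
      · exact absurd (H.eq_of_mem_part h0 hw) (by decide)
      · exact absurd (H.eq_of_mem_part (h1 h) hw) (by decide)
      · exact h
    · exact fun h => ⟨Or.inr (Or.inr h), h2 h⟩

theorem isKstCopy_copyEdges {k t : ℕ} {i : Σ _ : V × Finset V, Finset V} (h0 : i.1.1 ∈ H.part 0)
    (h1 : i.1.2 ⊆ H.part 1) (h2 : i.2 ⊆ H.part 2) (hk0 : 0 < k) (hk : i.1.2.card = k)
    (ht : i.2.card = t) (hlink : ∀ y ∈ i.2, i.1.2 ⊆ H.middleLink i.1.1 y) :
    IsKstCopy H.shadowGraph (k + 1) t (insert i.1.1 i.1.2) i.2 (copyEdges i) := by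
  have hne : ∀ u ∈ insert i.1.1 i.1.2, ∀ y ∈ i.2, u ≠ y := by
    intro u hu y hy
    rcases mem_insert.1 hu with rfl | hu
    · exact H.ne_of_mem_part (by decide) h0 (h2 hy)
    · exact H.ne_of_mem_part (by decide) (h1 hu) (h2 hy)
  refine ⟨disjoint_left.2 fun u hu hu' => hne u hu u hu' rfl, ?_, ht, ?_, rfl⟩
  · rw [card_insert_of_notMem, hk]
    exact fun h => H.ne_of_mem_part (by decide) h0 (h1 h) rfl
  · intro u hu y hy
    refine ⟨hne u hu y hy, ?_⟩
    rcases mem_insert.1 hu with rfl | hu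
    -- Adjacency of v and y is witnessed by a hyperedge through some leaf x, so X must be nonempty.
    · obtain ⟨x, hx⟩ := card_pos.1 (hk ▸ hk0)
      exact ⟨_, (mem_filter.1 (hlink y hy hx)).2, by simp, by simp⟩
    · exact ⟨_, (mem_filter.1 (hlink y hy hu)).2, by simp, by simp⟩

/-- A family of trimmed links whose weighted degrees are dominated by `q φ` yields a large
collection of copies of `K_{k+1,t}` with all degrees bounded by `φ`. -/
theorem exists_collection (k t : ℕ) (hk : 1 ≤ k) (ht : 1 ≤ t) (P : Finset (V × V))
    (D : V → V → Finset V) (d : ℕ) (hP : ∀ p ∈ P, p.1 ∈ H.part 0 ∧ p.2 ∈ H.part 2)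
    (hDl : ∀ p ∈ P, D p.1 p.2 ⊆ H.middleLink p.1 p.2) (hD : ∀ p ∈ P, (D p.1 p.2).card = d)
    (q₀ r q Δ c : ℝ) (φ : Finset V → ℝ) (hr0 : 0 < r) (hrt : (t : ℝ) ≤ r)
    (hq₀ : ((starLeaves P D k).card : ℝ) ≤ q₀)
    (hr : 2 * q₀ * r ≤ (P.card : ℝ) * d.choose k) (hc : c = 2 ^ t * (t ^ t * t.factorial : ℝ))
    (hΔ : ∀ x ∈ H.part 1, ∀ y ∈ H.part 2, ((H.firstLink x y).card : ℝ) ≤ Δ)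
    (hφ : ∀ ν a b, (ν ∩ (H.part 0 ∪ H.part 1)).card = a → (ν ∩ H.part 2).card = b →
      1 ≤ a → a ≤ k + 1 → 1 ≤ b → b ≤ t → 1 ≤ φ ν)
    (hφ₁ : ∀ ν a b, (ν ∩ H.part 0).Nonempty → (ν ∩ (H.part 0 ∪ H.part 1)).card = a →
      (ν ∩ H.part 2).card = b → 1 ≤ a → a ≤ k + 1 → 1 ≤ b → b ≤ t →
      c / r ^ (b - 1) * (d : ℝ) ^ (k + 1 - a) ≤ q * φ ν)
    (hφ₂ : ∀ ν a b, ¬ (ν ∩ H.part 0).Nonempty → (ν ∩ (H.part 0 ∪ H.part 1)).card = a →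
      (ν ∩ H.part 2).card = b → 1 ≤ a → a ≤ k → 1 ≤ b → b ≤ t →
      c / r ^ (b - 1) * (Δ * (d : ℝ) ^ (k - a)) ≤ q * φ ν)
    (hq : c / r ^ (t - 1) ≤ q) :
    ∃ 𝒢 : Finset (Finset (Sym2 V)),
      (∀ F ∈ 𝒢, ∃ S T : Finset V, IsKstCopy H.shadowGraph (k + 1) t S T F ∧
        (S ∩ H.part 0).card = 1 ∧ (S ∩ H.part 1).card = k ∧ T ⊆ H.part 2) ∧
      (P.card : ℝ) * d.choose k / 2 ≤ (2 * 2 ^ (k + 1 + t) + 1) * q * (𝒢.card : ℝ) ∧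
      ∀ σ : Finset (Sym2 V), (edgeVertices σ ∩ (H.part 0 ∪ H.part 1)).card ≠ 0 →
        (edgeVertices σ ∩ H.part 2).card ≠ 0 →
        collectionDegree 𝒢 σ = 0 ∨ (collectionDegree 𝒢 σ : ℝ) ≤ φ (edgeVertices σ) := by
  classical
  have hc0 : 0 ≤ c := by rw [hc]; positivity
  have hq0 : 0 ≤ q := le_trans (by positivity) hq
  set U := richCopies P D k t r with hU
  have hpart : ∀ i ∈ U, i.1.1 ∈ H.part 0 ∧ i.1.2 ⊆ H.part 1 ∧ i.2 ⊆ H.part 2 ∧ i.1.2.card = k ∧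
      i.2.card = t ∧ ∀ y ∈ i.2, i.1.2 ⊆ H.middleLink i.1.1 y :=
    fun i hi => H.mem_parts_of_mem_richCopies hP hDl hi
  have hinter : ∀ i ∈ U, copyVertices i ∩ H.part 0 = {i.1.1} ∧
      copyVertices i ∩ H.part 1 = i.1.2 ∧ copyVertices i ∩ H.part 2 = i.2 := fun i hi =>
    H.copyVertices_inter_part (hpart i hi).1 (hpart i hi).2.1 (hpart i hi).2.2.1
  have hcardS : ∀ i ∈ U, (insert i.1.1 i.1.2).card ≤ k + 1 := fun i hi =>
    (card_insert_le _ _).trans (by rw [(hpart i hi).2.2.2.1])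
  set sub : (Σ _ : V × Finset V, Finset V) → Finset (Finset V) := fun i =>
    (copyVertices i).powerset.filter fun ν =>
      (ν ∩ (H.part 0 ∪ H.part 1)).Nonempty ∧ (ν ∩ H.part 2).Nonempty with hsub
  have hmem : ∀ i ν, ν ∈ sub i ↔ ν ⊆ copyVertices i ∧
      (ν ∩ (H.part 0 ∪ H.part 1)).Nonempty ∧ (ν ∩ H.part 2).Nonempty := by
    intro i ν
    simp only [hsub, mem_filter, mem_powerset]
  have hsplit : ∀ ν : Finset V, (ν ∩ (H.part 0 ∪ H.part 1)).card =
      (ν ∩ H.part 0).card + (ν ∩ H.part 1).card := by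
    intro ν
    rw [inter_union_distrib_left, card_union_of_disjoint]
    exact (H.disjoint_part (by decide)).mono inter_subset_right inter_subset_right
  have hbounds : ∀ i ∈ U, ∀ ν ⊆ copyVertices i, ν ∩ H.part 0 ⊆ {i.1.1} ∧ ν ∩ H.part 1 ⊆ i.1.2 ∧
      ν ∩ H.part 2 ⊆ i.2 := by
    intro i hi ν hν
    obtain ⟨e0, e1, e2⟩ := hinter i hi
    exact ⟨e0 ▸ inter_subset_inter_right hν, e1 ▸ inter_subset_inter_right hν,
      e2 ▸ inter_subset_inter_right hν⟩
  have hcards : ∀ i ∈ U, ∀ ν ⊆ copyVertices i, (ν ∩ H.part 0).card ≤ 1 ∧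
      (ν ∩ H.part 1).card ≤ k ∧ (ν ∩ H.part 2).card ≤ t := by
    intro i hi ν hν
    obtain ⟨e0, e1, e2⟩ := hbounds i hi ν hν
    exact ⟨(card_le_card e0).trans (card_singleton _).le,
      (card_le_card e1).trans (hpart i hi).2.2.2.1.le,
      (card_le_card e2).trans (hpart i hi).2.2.2.2.1.le⟩
  have hmain := exists_bounded_degree_subfamily U sub (copyWeight P D t) φ q (2 ^ (k + 1 + t)) hq0
    (fun i _ => copyWeight_nonneg P D t i) ?_ ?_ ?_ ?_
  · obtain ⟨𝒢, h𝒢U, h𝒢d, h𝒢c⟩ := hmain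
    have hvert : ∀ i ∈ U, edgeVertices (copyEdges i) = copyVertices i := fun i hi =>
      edgeVertices_copyEdges i (card_pos.1 (by rw [(hpart i hi).2.2.2.2.1]; exact ht))
    refine ⟨𝒢.image copyEdges, ?_, ?_, ?_⟩
    · intro F hF
      obtain ⟨i, hi, rfl⟩ := mem_image.1 hF
      obtain ⟨h0, h1, h2, h3, h4, h5⟩ := hpart i (h𝒢U hi)
      have e : insert i.1.1 i.1.2 ∩ H.part 0 = {i.1.1} ∧ insert i.1.1 i.1.2 ∩ H.part 1 = i.1.2 := by
        have := H.copyVertices_inter_part (i := ⟨i.1, ∅⟩) h0 h1 (empty_subset _)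
        simp only [copyVertices, union_empty] at this
        exact ⟨this.1, this.2.1⟩
      refine ⟨insert i.1.1 i.1.2, i.2, H.isKstCopy_copyEdges h0 h1 h2 hk h3 h4 h5, ?_, ?_, h2⟩
      · rw [e.1, card_singleton]
      · rw [e.2, h3]
    · rw [card_image_of_injOn]
      · exact (half_le_sum_copyWeight P D k t d hD q₀ r hq₀ hr0.le hr hrt).trans h𝒢c
      -- The edge set determines the vertex set, and intersecting with the three parts recovers v, X
      -- and T.
      · intro i hi j hj hij
        have hv : copyVertices i = copyVertices j := by
          rw [← hvert i (h𝒢U hi), ← hvert j (h𝒢U hj), hij]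
        obtain ⟨a0, a1, a2⟩ := hinter i (h𝒢U hi)
        obtain ⟨b0, b1, b2⟩ := hinter j (h𝒢U hj)
        rw [hv] at a0 a1 a2
        obtain ⟨⟨v, X⟩, T⟩ := i
        obtain ⟨⟨v', X'⟩, T'⟩ := j
        have c0 := singleton_injective (a0.symm.trans b0)
        have c1 := a1.symm.trans b1
        have c2 := a2.symm.trans b2
        simp only at c0 c1 c2
        subst c0 c1 c2
        rfl
    · intro σ ha hb
      have hle : collectionDegree (𝒢.image copyEdges) σ ≤
          (𝒢.filter fun i => edgeVertices σ ∈ sub i).card := by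
        unfold collectionDegree
        rw [filter_image]
        refine card_image_le.trans (card_le_card fun i hi => ?_)
        obtain ⟨hi1, hi2⟩ := mem_filter.1 hi
        refine mem_filter.2 ⟨hi1, (hmem _ _).2 ⟨?_, card_pos.1 (Nat.pos_of_ne_zero ha),
          card_pos.1 (Nat.pos_of_ne_zero hb)⟩⟩
        rw [← hvert i (h𝒢U hi1)]
        exact edgeVertices_mono hi2
      -- A vertex set lying in no rich copy need not satisfy φ ≥ 1, but then no member of the
      -- collection contains σ.
      by_cases hσ : edgeVertices σ ∈ U.biUnion sub
      · right
        exact le_trans (by exact_mod_cast hle) (h𝒢d _ hσ)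
      · left
        rw [filter_eq_empty_iff.2] at hle
        · simpa using hle
        · intro i hi hi'
          exact hσ (mem_biUnion.2 ⟨i, h𝒢U hi, hi'⟩)
  · intro i hi
    have h1 : (sub i).card ≤ 2 ^ (copyVertices i).card := by
      rw [← card_powerset]
      exact card_filter_le _ _
    have h2 : (copyVertices i).card ≤ k + 1 + t :=
      (card_union_le _ _).trans (Nat.add_le_add (hcardS i hi) (hpart i hi).2.2.2.2.1.le)
    exact_mod_cast h1.trans (Nat.pow_le_pow_right (by norm_num) h2)
  · intro ν hν
    obtain ⟨i, hi, hiν⟩ := mem_biUnion.1 hν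
    obtain ⟨h1, h2, h3⟩ := (hmem _ _).1 hiν
    obtain ⟨c0, c1, c2⟩ := hcards i hi ν h1
    refine hφ ν _ _ rfl rfl (card_pos.2 h2) ?_ (card_pos.2 h3) c2
    rw [hsplit]
    omega
  · intro ν hν
    obtain ⟨i, hi, hiν⟩ := mem_biUnion.1 hν
    obtain ⟨h1, h2, h3⟩ := (hmem _ _).1 hiν
    obtain ⟨c0, c1, c2⟩ := hcards i hi ν h1
    have hgen : ∀ S : Finset V, (∀ j ∈ U, ν ⊆ copyVertices j → j.1.1 ∈ S) →
        ∑ j ∈ U.filter (fun j => ν ∈ sub j), copyWeight P D t j ≤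
          c / r ^ ((ν ∩ H.part 2).card - 1) *
            ((S.card : ℝ) * (d : ℝ) ^ (k - (ν ∩ H.part 1).card)) := by
      intro S hS
      rw [hc]
      refine le_trans ?_ (sum_copyWeight_filter_le P D k t d hD r hr0 hrt S (ν ∩ H.part 1)
        (ν ∩ H.part 2) (card_pos.2 h3) c2)
      refine sum_le_sum_of_subset_of_nonneg ?_ fun j _ _ => copyWeight_nonneg P D t j
      intro j hj
      obtain ⟨hj1, hj2⟩ := mem_filter.1 hj
      have hj3 := ((hmem _ _).1 hj2).1
      obtain ⟨_, e1, e2⟩ := hbounds j hj1 ν hj3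
      exact mem_filter.2 ⟨hj1, hS j hj1 hj3, e1, e2⟩
    by_cases h0 : (ν ∩ H.part 0).Nonempty
    · have hone : (ν ∩ H.part 0).card = 1 := le_antisymm c0 (card_pos.2 h0)
      have hcardν := hsplit ν
      rw [hone] at hcardν
      refine (hgen {i.1.1} ?_).trans (le_trans (le_of_eq ?_)
        (hφ₁ ν _ _ h0 rfl rfl (card_pos.2 h2) (by omega) (card_pos.2 h3) c2))
      · intro j hj hνj
        obtain ⟨w, hw⟩ := h0
        have e1 := mem_singleton.1 ((hbounds i hi ν h1).1 hw)
        have e2 := mem_singleton.1 ((hbounds j hj ν hνj).1 hw)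
        rw [mem_singleton, ← e1, e2]
      · have : k + 1 - (ν ∩ (H.part 0 ∪ H.part 1)).card = k - (ν ∩ H.part 1).card := by omega
        rw [this, card_singleton, Nat.cast_one, one_mul]
    · have hzero : (ν ∩ H.part 0).card = 0 := by
        rw [not_nonempty_iff_eq_empty] at h0
        rw [h0, card_empty]
      have hcardν := hsplit ν
      rw [hzero, zero_add] at hcardν
      obtain ⟨x, hx⟩ : (ν ∩ H.part 1).Nonempty := card_pos.1 (hcardν ▸ card_pos.2 h2)
      obtain ⟨y, hy⟩ := h3
      -- When ν misses V₁, the vertex v of any copy containing ν completes {x, y} to a hyperedge, so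
      -- the codegree Δ bounds its choices.
      refine (hgen (H.firstLink x y) ?_).trans (le_trans ?_
        (hφ₂ ν _ _ h0 rfl rfl (card_pos.2 h2) (by omega) (card_pos.2 ⟨y, hy⟩) c2))
      · intro j hj hνj
        obtain ⟨p0, p1, p2, _, _, p5⟩ := hpart j hj
        obtain ⟨_, e1, e2⟩ := hbounds j hj ν hνj
        exact mem_filter.2 ⟨p0, (mem_filter.1 (p5 y (e2 hy) (e1 hx))).2⟩
      · rw [hcardν]
        have := hΔ x (mem_inter.1 hx).2 y (mem_inter.1 hy).2
        gcongr
  · intro i hi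
    refine le_trans ?_ hq
    obtain ⟨⟨_, h2⟩, h3, h4⟩ := mem_richCopies.1 hi
    -- The weight of a single copy is bounded by the proportion estimate applied to Y' = T.
    have h5 := card_div_choose_mul_le (starCentres P D i.1) i.2 t r hr0 h2
      (by exact_mod_cast hrt.trans h2) (by rw [h4]; exact ht) h4.le
    rw [h4, ← hc] at h5
    refine le_trans ?_ h5
    refine le_mul_of_one_le_right (copyWeight_nonneg P D t i) ?_
    have : 1 ≤ ((powersetCard t (starCentres P D i.1)).filter fun T => i.2 ⊆ T).card :=
      card_pos.2 ⟨i.2, mem_filter.2 ⟨mem_powersetCard.2 ⟨h3, h4⟩, le_rfl⟩⟩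
    exact_mod_cast this

end TripartiteThreeGraph

/-! ### Numerical estimates -/

/-- Lower bounds for the number `Pc * d.choose k` of stars at a dyadic level `2 ^ j * h ≤ d`. -/
theorem star_count_bounds {m h Pc L κ : ℝ} {j d k : ℕ} (hh : 0 < h) (hPc : 0 ≤ Pc)
    (hk : 2 ≤ k) (hj : (3 / 4) ^ j * m / 8 ≤ Pc * 2 ^ j) (hjL : 2 ^ j ≤ 2 * L ^ 16)
    (hd : 2 ^ j * h ≤ d) (hκd : (d : ℝ) ^ k ≤ κ * d.choose k) :
    m * (d : ℝ) ^ k ≤ 32 * κ * L ^ 32 * (Pc * d.choose k) ∧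
      2 * m * h * (d : ℝ) ^ (k - 1) ≤ 32 * κ * L ^ 16 * (Pc * d.choose k) ∧
      2 * m * h * h ^ (k - 1) ≤ 16 * κ * (Pc * d.choose k) := by
  obtain ⟨k, rfl⟩ : ∃ i, k = i + 2 := ⟨k - 2, by omega⟩
  have hk1 : k + 2 - 1 = k + 1 := by omega
  rw [hk1]
  set x : ℝ := 2 ^ j with hx
  set y : ℝ := (4 / 3) ^ j with hy
  have hy1 : 1 ≤ y := one_le_pow₀ (by norm_num)
  have hyx : y ≤ x := pow_le_pow_left₀ (by norm_num) (by norm_num) j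
  have hx0 : 0 < x := by positivity
  have hy0 : 0 < y := by positivity
  have hinv : (3 / 4 : ℝ) ^ j * y = 1 := by
    rw [hy, ← mul_pow]
    norm_num
  have hm8 : m ≤ 8 * Pc * x * y := by
    have := mul_le_mul_of_nonneg_right hj hy0.le
    have e : (3 / 4 : ℝ) ^ j * m / 8 * y = ((3 / 4 : ℝ) ^ j * y) * m / 8 := by ring
    rw [e, hinv] at this
    linarith
  have hL16 : 0 ≤ L ^ 16 := by linarith
  have hZ : Pc * (d : ℝ) ^ (k + 2) ≤ κ * (Pc * d.choose (k + 2)) := by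
    have := mul_le_mul_of_nonneg_left hκd hPc
    linarith
  have hd0 : (0 : ℝ) ≤ d := Nat.cast_nonneg d
  refine ⟨?_, ?_, ?_⟩
  · have hxy : x * y ≤ 4 * L ^ 32 := by
      calc x * y ≤ x * x := by gcongr
        _ ≤ (2 * L ^ 16) * (2 * L ^ 16) := by gcongr
        _ = 4 * L ^ 32 := by ring
    calc m * (d : ℝ) ^ (k + 2) ≤ (8 * Pc * x * y) * (d : ℝ) ^ (k + 2) := by gcongr
      _ = 8 * (x * y) * (Pc * (d : ℝ) ^ (k + 2)) := by ring
      _ ≤ 8 * (4 * L ^ 32) * (κ * (Pc * d.choose (k + 2))) := by gcongr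
      _ = _ := by ring
  · calc 2 * m * h * (d : ℝ) ^ (k + 1) ≤ 2 * (8 * Pc * x * y) * h * (d : ℝ) ^ (k + 1) := by gcongr
      _ = 16 * Pc * y * (x * h) * (d : ℝ) ^ (k + 1) := by ring
      _ ≤ 16 * Pc * (2 * L ^ 16) * d * (d : ℝ) ^ (k + 1) := by
        have := hyx.trans hjL
        gcongr
      _ = 32 * L ^ 16 * (Pc * (d : ℝ) ^ (k + 2)) := by ring
      _ ≤ 32 * L ^ 16 * (κ * (Pc * d.choose (k + 2))) := by gcongr
      _ = _ := by ring
  -- No power of L is lost here: two factors d ≥ 2^j h pay for 2^j and for (4/3)^j ≤ 2^j, which is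
  -- where k ≥ 2 enters.
  · have hx1 : 1 ≤ x := hy1.trans hyx
    have hhd : h ≤ d := le_trans (le_mul_of_one_le_left hh.le hx1) hd
    calc 2 * m * h * h ^ (k + 1) ≤ 2 * (8 * Pc * x * y) * h * h ^ (k + 1) := by gcongr
      _ ≤ 2 * (8 * Pc * x * x) * h * h ^ (k + 1) := by gcongr
      _ = 16 * Pc * ((x * h) * (x * h) * h ^ k) := by ring
      _ ≤ 16 * Pc * (d * d * (d : ℝ) ^ k) := by gcongr
      _ = 16 * (Pc * (d : ℝ) ^ (k + 2)) := by ring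
      _ ≤ 16 * (κ * (Pc * d.choose (k + 2))) := by gcongr
      _ = _ := by ring

/-- Without the factors δ, the denominator is largest at a = k + 1, b = t, where it is at most U B^k
A^{t-1} = M. -/
theorem one_le_phi_value {M U A B N δ μ : ℝ} {k t a b : ℕ} (hM : M = N * A ^ t)
    (hUB : U * B ^ k = N * A) (hA : 1 ≤ A) (hB : 1 ≤ B) (hδ : 0 < δ) (hδ1 : δ ≤ 1) (hμ : 0 < μ)
    (hμU : μ ≤ U) (ha' : a ≤ k + 1) (hb : 1 ≤ b) (hb' : b ≤ t) :
    1 ≤ M / (δ * μ * (δ * B) ^ (a - 1) * (δ * A) ^ (b - 1)) := by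
  have hA0 : 0 < A := by linarith
  have hB0 : 0 < B := by linarith
  have hU0 : 0 < U := by linarith
  rw [one_le_div (by positivity)]
  have hδB : δ * B ≤ B := mul_le_of_le_one_left hB0.le hδ1
  have hδA : δ * A ≤ A := mul_le_of_le_one_left hA0.le hδ1
  calc δ * μ * (δ * B) ^ (a - 1) * (δ * A) ^ (b - 1)
      ≤ 1 * U * B ^ (a - 1) * A ^ (b - 1) := by gcongr
    _ ≤ 1 * U * B ^ k * A ^ (t - 1) := by
        have h1 : B ^ (a - 1) ≤ B ^ k := pow_le_pow_right₀ hB (by omega)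
        have h2 : A ^ (b - 1) ≤ A ^ (t - 1) := pow_le_pow_right₀ hA (by omega)
        gcongr
    _ = M := by
        rw [one_mul, hUB, hM, mul_assoc, ← pow_succ']
        congr 2
        omega

/-- Since δB ≤ d and δA ≤ r, the powers in φ are dominated by d^{a-1} and r^{b-1}. The r-powers
cancel, so one inequality serves all b; the leading δ remains to absorb constants. -/
theorem div_pow_mul_le_phi_value {M A B δ μ c r L Z G d : ℝ} {a b p : ℕ} (hM : 0 < M)
    (hA : 0 < A) (hB : 0 < B) (hδ : 0 < δ) (hμ : 0 < μ) (hr : 0 < r) (hc : 0 ≤ c) (hG : 0 ≤ G)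
    (hd : 0 ≤ d) (hδA : δ * A ≤ r) (hδB : δ * B ≤ d)
    (hmain : c * δ * (μ * G * d ^ (p + (a - 1))) ≤ L ^ 33 * Z) :
    c / r ^ (b - 1) * (G * d ^ p) ≤
      L ^ 33 * Z / M * (M / (δ * μ * (δ * B) ^ (a - 1) * (δ * A) ^ (b - 1))) := by
  have e : L ^ 33 * Z / M * (M / (δ * μ * (δ * B) ^ (a - 1) * (δ * A) ^ (b - 1))) =
      L ^ 33 * Z / (δ * μ * (δ * B) ^ (a - 1) * (δ * A) ^ (b - 1)) := by
    field_simp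
  rw [e, le_div_iff₀ (by positivity)]
  refine le_trans ?_ hmain
  calc c / r ^ (b - 1) * (G * d ^ p) * (δ * μ * (δ * B) ^ (a - 1) * (δ * A) ^ (b - 1))
      ≤ c / r ^ (b - 1) * (G * d ^ p) * (δ * μ * d ^ (a - 1) * r ^ (b - 1)) := by gcongr
    _ = c * δ * (μ * G * d ^ (p + (a - 1))) := by
      rw [pow_add]
      field_simp

theorem rpow_identities {ℓ K n s : ℝ} {k : ℕ} (hℓ : 0 < ℓ) (hK : 0 < K) (hn : 0 < n)
    (hs : s = k + 1) :
    K * n ^ (3 - 3 / s) = (ℓ * n ^ (2 - 1 / s)) * (ℓ⁻¹ * K * n ^ (1 - 2 / s)) ∧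
    (ℓ * n ^ (2 - 1 / s)) * (ℓ⁻¹ * K * n ^ (1 - 2 / s)) ^ k =
      (ℓ ^ (s - 1) * n ^ (s - 1 + 1 / s)) * (ℓ ^ (3 - 2 * s) * K ^ (s - 1)) ∧
    n * (ℓ * n ^ (1 - 1 / s)) ^ k = ℓ ^ (s - 1) * n ^ (s - 1 + 1 / s) := by
  have hs0 : s ≠ 0 := by rw [hs]; positivity
  have hk : (k : ℝ) = s - 1 := by rw [hs]; ring
  have hKk : K ^ k = K ^ (s - 1) := by rw [← Real.rpow_natCast, hk]
  have hℓk : ℓ ^ k = ℓ ^ (s - 1) := by rw [← Real.rpow_natCast, hk]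
  refine ⟨?_, ?_, ?_⟩
  · have : n ^ (3 - 3 / s) = n ^ (2 - 1 / s) * n ^ (1 - 2 / s) := by
      rw [← Real.rpow_add hn]
      congr 1
      ring
    rw [this]
    field_simp
  · have h1 : n ^ (2 - 1 / s) * (n ^ (1 - 2 / s)) ^ k = n ^ (s - 1 + 1 / s) := by
      rw [← Real.rpow_natCast (n ^ (1 - 2 / s)), ← Real.rpow_mul hn.le, ← Real.rpow_add hn, hk]
      congr 1
      field_simp
      ring
    have h2 : ℓ * (ℓ⁻¹) ^ k = ℓ ^ (s - 1) * ℓ ^ (3 - 2 * s) := by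
      rw [inv_pow, hℓk, ← Real.rpow_neg hℓ.le, ← Real.rpow_add hℓ]
      nth_rewrite 1 [← Real.rpow_one ℓ]
      rw [← Real.rpow_add hℓ]
      congr 1
      ring
    rw [mul_pow, mul_pow, hKk]
    calc _ = (ℓ * (ℓ⁻¹) ^ k) * K ^ (s - 1) * (n ^ (2 - 1 / s) * (n ^ (1 - 2 / s)) ^ k) := by ring
      _ = _ := by rw [h1, h2]; ring
  · have h1 : n * (n ^ (1 - 1 / s)) ^ k = n ^ (s - 1 + 1 / s) := by
      rw [← Real.rpow_natCast (n ^ (1 - 1 / s)), ← Real.rpow_mul hn.le, hk]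
      nth_rewrite 1 [← Real.rpow_one n]
      rw [← Real.rpow_add hn]
      congr 1
      field_simp
      ring
    rw [mul_pow, hℓk, ← h1]
    ring

/-- The first bound is the upper bound on ℓ raised to the power 2s - 3. For the second, that upper
bound forces K ≥ 1, and the exponent (s-1)/(2s-3) is at most 1. -/
theorem inv_le_of_le_mul_rpow {ℓ K δ s : ℝ} (hs : 3 ≤ s) (hδ : 0 < δ) (hδ1 : δ ≤ 1) (hK : 0 < K)
    (hℓ : δ⁻¹ ≤ ℓ) (hℓK : ℓ ≤ δ * K ^ ((s - 1) / (2 * s - 3))) :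
    δ⁻¹ ≤ ℓ ^ (3 - 2 * s) * K ^ (s - 1) ∧ δ⁻¹ ≤ ℓ⁻¹ * K := by
  have hℓ0 : 0 < ℓ := (inv_pos.2 hδ).trans_le hℓ
  have hs3 : 0 < 2 * s - 3 := by linarith
  constructor
  · have h1 : ℓ ^ (2 * s - 3) ≤ δ * K ^ (s - 1) := by
      calc ℓ ^ (2 * s - 3) ≤ (δ * K ^ ((s - 1) / (2 * s - 3))) ^ (2 * s - 3) :=
            Real.rpow_le_rpow hℓ0.le hℓK hs3.le
        _ = δ ^ (2 * s - 3) * K ^ (s - 1) := by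
            rw [Real.mul_rpow hδ.le (by positivity), ← Real.rpow_mul hK.le,
              div_mul_cancel₀ _ hs3.ne']
        _ ≤ δ * K ^ (s - 1) := by
            refine mul_le_mul_of_nonneg_right ?_ (by positivity)
            exact Real.rpow_le_self_of_le_one hδ.le hδ1 (by linarith)
    have h2 : ℓ ^ (3 - 2 * s) = (ℓ ^ (2 * s - 3))⁻¹ := by
      rw [← Real.rpow_neg hℓ0.le]
      congr 1
      ring
    have h3 : 0 < ℓ ^ (2 * s - 3) := by positivity
    rw [h2, inv_mul_eq_div, le_div_iff₀ h3, inv_mul_le_iff₀ hδ]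
    exact h1
  · have h1 : δ⁻¹ * ℓ ≤ K ^ ((s - 1) / (2 * s - 3)) := by rwa [inv_mul_le_iff₀ hδ]
    have h1δ : 1 ≤ δ⁻¹ := (one_le_inv₀ hδ).2 hδ1
    have h2 : 1 ≤ K ^ ((s - 1) / (2 * s - 3)) := by
      have : 1 ≤ δ⁻¹ * ℓ := one_le_mul_of_one_le_of_one_le h1δ (h1δ.trans hℓ)
      linarith
    have he0 : 0 < (s - 1) / (2 * s - 3) := div_pos (by linarith) hs3
    have hK1 : 1 ≤ K := by
      by_contra! hlt
      exact absurd (Real.rpow_lt_one hK.le hlt he0) (not_lt.2 h2)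
    have he1 : (s - 1) / (2 * s - 3) ≤ 1 := by
      rw [div_le_one hs3]
      linarith
    have h3 : K ^ ((s - 1) / (2 * s - 3)) ≤ K := by
      simpa using Real.rpow_le_rpow_of_exponent_le hK1 he1
    rw [inv_mul_eq_div, le_div_iff₀ hℓ0]
    exact h1.trans h3

/-- A constant depending only on `k = s - 1` and `t`, which a factor `log n` has to absorb. -/
def absorbConst (k t : ℕ) : ℕ :=
  2 * (2 * 2 ^ (k + 1 + t) + 1) + 2 ^ t * (t ^ t * t.factorial) * (32 * (k ^ k * k.factorial)) +
    (32 * (k ^ k * k.factorial) * 2 ^ (k - 1)) * t +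
    2 ^ t * (t ^ t * t.factorial) * (32 * (k ^ k * k.factorial) * 2 ^ (k - 1)) ^ t +
    32 * (k ^ k * k.factorial) * 2 ^ (k - 1) + k + 12

/-! ### Supersaturation in normalised parameters -/

namespace TripartiteThreeGraph

variable {V : Type*} [Fintype V] [DecidableEq V] (H : TripartiteThreeGraph V)

theorem m_pos_of_mem_edges {e : Finset V} (he : e ∈ H.edges) : 0 < H.m 0 2 ∧ 0 < H.m 1 2 := by
  obtain ⟨v, hv, x, hx, y, hy, rfl⟩ := H.exists_eq_triple he
  exact ⟨card_pos.2 ⟨_, H.pair_mem_shadowPairs (by decide) hv hy he (by simp) (by simp)⟩,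
    card_pos.2 ⟨_, H.pair_mem_shadowPairs (by decide) hx hy he (by simp) (by simp)⟩⟩

theorem card_middleLink_le_of_edgeDegree_le {E : ℝ}
    (h : ∀ e ∈ H.shadowPairs 0 2, (H.edgeDegree e : ℝ) ≤ E) {p : V × V} (hp : p ∈ H.outerPairs) :
    ((H.middleLink p.1 p.2).card : ℝ) ≤ E := by
  obtain ⟨h1, h2⟩ := mem_product.1 (mem_filter.1 hp).1
  refine le_trans ?_ (h _ (H.pair_mem_shadowPairs_of_mem_outerPairs hp))
  exact_mod_cast H.card_middleLink_le h1 h2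

theorem card_firstLink_le_of_edgeDegree_le {E : ℝ} (hE : 0 ≤ E)
    (h : ∀ e ∈ H.shadowPairs 1 2, (H.edgeDegree e : ℝ) ≤ E) {x y : V} (hx : x ∈ H.part 1)
    (hy : y ∈ H.part 2) : ((H.firstLink x y).card : ℝ) ≤ E := by
  rcases (H.firstLink x y).eq_empty_or_nonempty with h0 | ⟨v, hv⟩
  · rw [h0]
    simpa using hE
  · refine le_trans ?_ (h {x, y} (H.pair_mem_shadowPairs (by decide) hx hy
      (mem_filter.1 hv).2 (by simp) (by simp)))
    exact_mod_cast H.card_firstLink_le hx hy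

/-- The real number that `phi` takes as value on vertex sets meeting both `V₁ ∪ V₂` and `V₃`. -/
noncomputable def phiValue (M A B δ : ℝ) (ν : Finset V) : ℝ :=
  M / (δ * ((if (ν ∩ H.part 0).Nonempty then H.m 0 2 else H.m 1 2 : ℕ) : ℝ) *
    (δ * B) ^ ((ν ∩ (H.part 0 ∪ H.part 1)).card - 1) * (δ * A) ^ ((ν ∩ H.part 2).card - 1))

set_option maxHeartbeats 1000000 in
/-- The supersaturation statement in terms of `A`, `B`, `U`, `N` and `L = 12 log n`. -/
theorem exists_collection_of_density (k t : ℕ) (hk : 2 ≤ k) (ht : 1 ≤ t) {A B U N L Λ δ n : ℝ}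
    (hδ : 0 < δ) (hδW : δ * absorbConst k t ≤ 1) (hA : δ⁻¹ ≤ A) (hB : δ⁻¹ ≤ B) (hU : 0 < U)
    (hN : 0 < N) (hUB : U * B ^ k = N * A) (hL0 : 0 < L)
    (hn : ((H.part 1).card : ℝ) ≤ n) (hLn : B / 2 ≤ n → (absorbConst k t : ℝ) ≤ L)
    (hE : U * B * L ^ 16 ≤ (H.edges.card : ℝ))
    (hm02 : (H.m 0 2 : ℝ) ≤ U) (hm12 : (H.m 1 2 : ℝ) ≤ U)
    (hdeg : ∀ i j, i ≠ j → ∀ e ∈ H.shadowPairs i j,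
      (H.edgeDegree e : ℝ) ≤ U * B * (H.m i j : ℝ)⁻¹ * L ^ 32)
    (hΛ : ∀ v ∈ H.part 0, (H.degreeInto v 1 : ℝ) ≤ Λ)
    (hΛN : ((H.part 0).card : ℝ) * Λ ^ k ≤ N * L ^ (16 * k)) :
    ∃ 𝒢 : Finset (Finset (Sym2 V)),
      (∀ F ∈ 𝒢, ∃ S T : Finset V, IsKstCopy H.shadowGraph (k + 1) t S T F ∧
        (S ∩ H.part 0).card = 1 ∧ (S ∩ H.part 1).card = k ∧ T ⊆ H.part 2) ∧
      N * A ^ t ≤ L ^ 34 * (𝒢.card : ℝ) ∧ (absorbConst k t : ℝ) ≤ L ∧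
      ∀ σ : Finset (Sym2 V), (edgeVertices σ ∩ (H.part 0 ∪ H.part 1)).card ≠ 0 →
        (edgeVertices σ ∩ H.part 2).card ≠ 0 →
        collectionDegree 𝒢 σ = 0 ∨
          (collectionDegree 𝒢 σ : ℝ) ≤ H.phiValue (N * A ^ t) A B δ (edgeVertices σ) := by
  classical
  -- constants
  obtain ⟨κ, hκdef⟩ : ∃ κ : ℝ, κ = (k ^ k * k.factorial : ℕ) := ⟨_, rfl⟩
  obtain ⟨c, hc⟩ : ∃ c : ℝ, c = 2 ^ t * (t ^ t * t.factorial : ℝ) := ⟨_, rfl⟩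
  obtain ⟨lam, hlam⟩ : ∃ lam : ℝ, lam = 32 * κ * 2 ^ (k - 1) := ⟨_, rfl⟩
  have hW : (absorbConst k t : ℝ) = 2 * (2 * 2 ^ (k + 1 + t) + 1) + c * (32 * κ) + lam * t +
      c * lam ^ t + lam + k + 12 := by
    rw [hlam, hc, hκdef]
    unfold absorbConst
    push_cast
    ring
  have hκ1 : 1 ≤ κ := by
    rw [hκdef]
    exact_mod_cast Nat.mul_pos (pow_pos (by omega) k) (Nat.factorial_pos k)
  have hc0 : 0 ≤ c := by rw [hc]; positivity
  have hlam0 : 0 < lam := by rw [hlam]; positivity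
  have t1 : (0 : ℝ) ≤ 2 * (2 * 2 ^ (k + 1 + t) + 1) := by positivity
  have t2 : 0 ≤ c * (32 * κ) := by positivity
  have t3 : 0 ≤ lam * t := by positivity
  have t4 : 0 ≤ c * lam ^ t := by positivity
  have t5 : (0 : ℝ) ≤ k := Nat.cast_nonneg k
  obtain ⟨W, hWdef⟩ : ∃ W : ℝ, W = absorbConst k t := ⟨_, rfl⟩
  rw [← hWdef] at hW hδW hLn
  have hWδ : W ≤ δ⁻¹ := by
    rw [← one_div, le_div_iff₀ hδ, mul_comm]
    exact hδW
  have hδle : ∀ x, x ≤ W → δ * x ≤ 1 := fun x hx =>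
    (mul_le_mul_of_nonneg_left hx hδ.le).trans hδW
  have hδ1 : δ ≤ 1 := by simpa using hδle 1 (by linarith)
  have h1A : 1 ≤ A := by linarith
  have hA0 : 0 < A := by linarith
  have h1B : 1 ≤ B := by linarith
  have hB0 : 0 < B := by linarith
  -- positivity and the bound on `L`
  have hEpos : 0 < H.edges.card := by
    have : (0 : ℝ) < H.edges.card := lt_of_lt_of_le (by positivity) hE
    exact_mod_cast this
  obtain ⟨e, he⟩ := card_pos.1 hEpos
  obtain ⟨hm0, hm'0⟩ := H.m_pos_of_mem_edges he
  set m : ℝ := (H.m 0 2 : ℝ) with hmdef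
  set m' : ℝ := (H.m 1 2 : ℝ) with hm'def
  have hm : 0 < m := Nat.cast_pos.2 hm0
  have hm' : 0 < m' := Nat.cast_pos.2 hm'0
  have hml : ∀ p ∈ H.outerPairs, ((H.middleLink p.1 p.2).card : ℝ) ≤ U * B * m⁻¹ * L ^ 32 :=
    fun p hp => H.card_middleLink_le_of_edgeDegree_le (hdeg 0 2 (by decide)) hp
  have hEsum : (H.edges.card : ℝ) ≤ ∑ p ∈ H.outerPairs, ((H.middleLink p.1 p.2).card : ℝ) := by
    exact_mod_cast H.card_edges_le
  have hPm : (H.outerPairs.card : ℝ) ≤ m := Nat.cast_le.2 H.card_outerPairs_le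
  -- The lower bound on the number of hyperedges and the codegree bound are compatible only if L^16
  -- ≤ L^32.
  have hL1 : 1 ≤ L := by
    have h1 : U * B * L ^ 16 ≤ U * B * L ^ 32 := by
      calc U * B * L ^ 16 ≤ ∑ p ∈ H.outerPairs, U * B * m⁻¹ * L ^ 32 :=
            hE.trans (hEsum.trans (sum_le_sum hml))
        _ = H.outerPairs.card * (U * B * m⁻¹ * L ^ 32) := by rw [sum_const, nsmul_eq_mul]
        _ ≤ m * (U * B * m⁻¹ * L ^ 32) := by gcongr
        _ = U * B * L ^ 32 := by field_simp
    have h2 : L ^ 16 ≤ L ^ 32 := le_of_mul_le_mul_left h1 (by positivity)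
    have h3 : 1 ≤ L ^ 16 := by
      have : L ^ 16 * 1 ≤ L ^ 16 * L ^ 16 := by
        rw [mul_one, ← pow_add]
        exact h2
      exact le_of_mul_le_mul_left this (by positivity)
    by_contra! hlt
    exact absurd (pow_lt_one₀ hL0.le hlt (by norm_num : (16 : ℕ) ≠ 0)) (not_lt.2 h3)
  -- the dyadic level
  obtain ⟨h, hhdef⟩ : ∃ h : ℝ, h = U * B * L ^ 16 / (2 * m) := ⟨_, rfl⟩
  have hh : 0 < h := by rw [hhdef]; positivity
  have h2mh : 2 * m * h = U * B * L ^ 16 := by rw [hhdef]; field_simp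
  have hhB : B * L ^ 16 / 2 ≤ h := by
    rw [hhdef, div_le_div_iff₀ (by norm_num) (by positivity)]
    have := mul_le_mul_of_nonneg_left hm02 (by positivity : 0 ≤ B * L ^ 16 * 2)
    linarith
  have hL16 : 1 ≤ L ^ 16 := one_le_pow₀ hL1
  have hhB2 : B / 2 ≤ h := by
    have : B * 1 ≤ B * L ^ 16 := by gcongr
    linarith
  obtain ⟨j, hj⟩ := exists_dyadic_level H.outerPairs (fun p => (H.middleLink p.1 p.2).card) m h hm hh
    hPm (by rw [h2mh]; exact hE.trans hEsum)
  set P := H.outerPairs.filter fun p => 2 ^ j * h ≤ ((H.middleLink p.1 p.2).card : ℝ) with hP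
  have hPne : P.Nonempty := by
    rw [nonempty_iff_ne_empty]
    intro h0
    rw [h0, card_empty, Nat.cast_zero, zero_mul] at hj
    have : (0 : ℝ) < (3 / 4) ^ j * m / 8 := by positivity
    linarith
  obtain ⟨p₀, hp₀⟩ := hPne
  obtain ⟨hp₀1, hp₀2⟩ := mem_filter.1 hp₀
  have h2j1 : (1 : ℝ) ≤ 2 ^ j := one_le_pow₀ (by norm_num)
  -- A link of size at least h ≥ B/2 fits in V₂, so B/2 ≤ n, which makes L large.
  have hWL : W ≤ L := by
    refine hLn (hhB2.trans (le_trans ?_ hn))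
    have h1 : ((H.middleLink p₀.1 p₀.2).card : ℝ) ≤ (H.part 1).card := by
      exact_mod_cast card_le_card (filter_subset _ _)
    exact (le_mul_of_one_le_left hh.le h2j1).trans (hp₀2.trans h1)
  have hjL : (2 : ℝ) ^ j ≤ 2 * L ^ 16 := by
    have h1 := hp₀2.trans (hml p₀ hp₀1)
    have h2 : U * B * m⁻¹ * L ^ 32 = 2 * L ^ 16 * h := by
      rw [hhdef]; field_simp
    rw [h2] at h1
    exact le_of_mul_le_mul_right h1 hh
  -- trimmed links
  obtain ⟨d, hddef⟩ : ∃ d : ℕ, d = ⌈(2 : ℝ) ^ j * h⌉₊ := ⟨_, rfl⟩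
  have hdle : (2 : ℝ) ^ j * h ≤ d := hddef ▸ Nat.le_ceil _
  have hhd : h ≤ d := (le_mul_of_one_le_left hh.le h2j1).trans hdle
  have hex : ∀ p : V × V, ∃ D ⊆ H.middleLink p.1 p.2, p ∈ P → D.card = d := by
    intro p
    by_cases hp : p ∈ P
    · have : d ≤ (H.middleLink p.1 p.2).card := by
        rw [hddef]
        exact Nat.ceil_le.2 (mem_filter.1 hp).2
      obtain ⟨D, h1, h2⟩ := exists_subset_card_eq this
      exact ⟨D, h1, fun _ => h2⟩
    · exact ⟨∅, empty_subset _, fun h => absurd h hp⟩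
  choose D' hD'1 hD'2 using hex
  set D : V → V → Finset V := fun v y => D' (v, y) with hD
  have hkd : k ≤ d := by
    have : (k : ℝ) ≤ d := by
      have h1 : 0 ≤ lam := hlam0.le
      have h3 : 2 * (k : ℝ) ≤ B := by
        have h6 : (2 : ℝ) * k ≤ lam := by
          have h7 : (k : ℝ) ≤ κ := by
            rw [hκdef]
            have : k ≤ k ^ k * k.factorial :=
              (Nat.le_self_pow (by omega) k).trans (Nat.le_mul_of_pos_right _ (Nat.factorial_pos k))
            exact_mod_cast this
          have h8 : (1 : ℝ) ≤ 2 ^ (k - 1) := one_le_pow₀ (by norm_num)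
          calc (2 : ℝ) * k ≤ 32 * κ * 1 := by linarith
            _ ≤ lam := by rw [hlam]; gcongr
        linarith
      linarith
    exact_mod_cast this
  have hPc : (0 : ℝ) ≤ P.card := Nat.cast_nonneg _
  have hκd : (d : ℝ) ^ k ≤ κ * d.choose k := by
    rw [hκdef]
    exact_mod_cast pow_le_mul_choose d k hkd
  obtain ⟨hZ1, hZ2, hZ3⟩ := star_count_bounds hh hPc hk hj hjL hdle hκd
  obtain ⟨Z, hZ⟩ : ∃ Z : ℝ, Z = P.card * d.choose k := ⟨_, rfl⟩
  rw [← hZ] at hZ1 hZ2 hZ3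
  -- Half the average number of centres, computed with the upper bound N L^{16k} on the number of
  -- leaf sets.
  obtain ⟨r, hrdef⟩ : ∃ r : ℝ, r = Z / (2 * (N * L ^ (16 * k))) := ⟨_, rfl⟩
  have hZr : 2 * (N * L ^ (16 * k)) * r = Z := by rw [hrdef]; field_simp
  have hAr : A ≤ lam * r := by
    have h1 : U * B * L ^ 16 * (B * L ^ 16 / 2) ^ (k - 1) ≤ 16 * κ * Z := by
      refine le_trans ?_ hZ3
      rw [h2mh]
      gcongr
    have h2 : U * B * L ^ 16 * (B * L ^ 16 / 2) ^ (k - 1) * 2 ^ (k - 1) =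
        N * A * L ^ (16 * k) := by
      rw [mul_assoc, ← mul_pow, div_mul_cancel₀ _ (by norm_num), mul_assoc U, mul_assoc U,
        ← pow_succ', Nat.sub_add_cancel (by omega), mul_pow, ← pow_mul, ← mul_assoc, hUB]
    have h3 := mul_le_mul_of_nonneg_right h1 (by positivity : (0 : ℝ) ≤ 2 ^ (k - 1))
    rw [h2, ← hZr] at h3
    refine le_of_mul_le_mul_left ?_ (by positivity : 0 < N * L ^ (16 * k))
    calc N * L ^ (16 * k) * A = N * A * L ^ (16 * k) := by ring
      _ ≤ _ := h3
      _ = N * L ^ (16 * k) * (lam * r) := by rw [hlam]; ring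
  have hr0 : 0 < r := by
    by_contra! hr
    have := mul_nonpos_of_nonneg_of_nonpos hlam0.le hr
    linarith
  have hrt : (t : ℝ) ≤ r := by
    have h1 : lam * t ≤ lam * r := by linarith
    exact le_of_mul_le_mul_left h1 hlam0
  have hδA : δ * A ≤ r := by
    calc δ * A ≤ δ * (lam * r) := by gcongr
      _ = (δ * lam) * r := by ring
      _ ≤ 1 * r := by
        have := hδle lam (by linarith)
        gcongr
      _ = r := one_mul r
  have hδB : δ * B ≤ d := by
    have h1 := hδle 2 (by linarith)
    have h2 := mul_le_mul_of_nonneg_right h1 hB0.le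
    linarith
  have hZ0 : 0 < Z := by rw [← hZr]; positivity
  have hcδ : c * δ * (32 * κ) ≤ 1 := by
    have := hδle (c * (32 * κ)) (by linarith)
    linarith
  have hL33 : ∀ x, x ≤ 32 * κ * L ^ 32 * Z → c * δ * x ≤ L ^ 33 * Z := by
    intro x hx
    calc c * δ * x ≤ c * δ * (32 * κ * L ^ 32 * Z) := by gcongr
      _ = (c * δ * (32 * κ)) * (L ^ 32 * Z) := by ring
      _ ≤ L * (L ^ 32 * Z) := by
        have := hcδ.trans hL1
        gcongr
      _ = L ^ 33 * Z := by ring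
  obtain ⟨M, hM⟩ : ∃ M : ℝ, M = N * A ^ t := ⟨_, rfl⟩
  have hM0 : 0 < M := by rw [hM]; positivity
  rw [← hM]
  have hmain := H.exists_collection k t (by omega) ht P D d
    (fun p hp => mem_product.1 (mem_filter.1 (mem_filter.1 hp).1).1)
    (fun p _ => hD'1 p) (fun p hp => hD'2 p hp) (N * L ^ (16 * k)) r (L ^ 33 * Z / M)
    (U * B * m'⁻¹ * L ^ 32) c (H.phiValue M A B δ) hr0 hrt
    ((H.card_starLeaves_le P D k (fun p hp => mem_product.1 (mem_filter.1 (mem_filter.1 hp).1).1)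
      (fun p _ => hD'1 p) Λ hΛ).trans hΛN)
    (by rw [hZr, hZ]) hc
    (fun x hx y hy => H.card_firstLink_le_of_edgeDegree_le (by positivity)
      (hdeg 1 2 (by decide)) hx hy) ?_ ?_ ?_ ?_
  · obtain ⟨𝒢, h𝒢1, h𝒢2, h𝒢3⟩ := hmain
    refine ⟨𝒢, h𝒢1, ?_, hWdef ▸ hWL, h𝒢3⟩
    rw [← hZ, mul_div_assoc', div_mul_eq_mul_div, div_le_div_iff₀ (by norm_num) hM0] at h𝒢2
    have hK : 2 * (2 * 2 ^ (k + 1 + t) + 1) ≤ L := by linarith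
    refine le_of_mul_le_mul_left ?_ hZ0
    calc Z * M ≤ (2 * 2 ^ (k + 1 + t) + 1) * (L ^ 33 * Z) * 𝒢.card * 2 := h𝒢2
      _ = (2 * (2 * 2 ^ (k + 1 + t) + 1)) * (L ^ 33 * Z * 𝒢.card) := by ring
      _ ≤ L * (L ^ 33 * Z * 𝒢.card) := by gcongr
      _ = Z * (L ^ 34 * 𝒢.card) := by ring
  · intro ν a b ha hb ha1 ha2 hb1 hb2
    unfold phiValue
    rw [ha, hb]
    split_ifs
    · exact one_le_phi_value hM hUB h1A h1B hδ hδ1 hm hm02 ha2 hb1 hb2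
    · exact one_le_phi_value hM hUB h1A h1B hδ hδ1 hm' hm12 ha2 hb1 hb2
  · intro ν a b h0 ha hb ha1 ha2 hb1 hb2
    unfold phiValue
    rw [ha, hb, if_pos h0, ← one_mul ((d : ℝ) ^ (k + 1 - a))]
    refine div_pow_mul_le_phi_value hM0 hA0 hB0 hδ hm hr0 hc0 zero_le_one (Nat.cast_nonneg d) hδA
      hδB ?_
    rw [mul_one, show k + 1 - a + (a - 1) = k by omega]
    exact hL33 _ hZ1
  · intro ν a b h0 ha hb ha1 ha2 hb1 hb2
    unfold phiValue
    rw [ha, hb, if_neg h0]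
    refine div_pow_mul_le_phi_value hM0 hA0 hB0 hδ hm' hr0 hc0 (by positivity) (Nat.cast_nonneg d)
      hδA hδB ?_
    rw [show k - a + (a - 1) = k - 1 by omega]
    refine hL33 _ ?_
    rw [h2mh] at hZ2
    -- The codegree bound is inversely proportional to m', so m' cancels and the estimate for m
    -- applies.
    calc m' * (U * B * m'⁻¹ * L ^ 32) * (d : ℝ) ^ (k - 1)
        = L ^ 16 * (U * B * L ^ 16 * (d : ℝ) ^ (k - 1)) := by field_simp
      _ ≤ L ^ 16 * (32 * κ * L ^ 16 * Z) := by gcongr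
      _ = 32 * κ * L ^ 32 * Z := by ring
  · rw [div_le_div_iff₀ (by positivity) hM0, hM, ← hZr]
    have h1 : c * lam ^ t ≤ L := by linarith
    have h2 : (1 : ℝ) ≤ L ^ 32 := one_le_pow₀ hL1
    have h3 : (1 : ℝ) ≤ L ^ (16 * k) := one_le_pow₀ hL1
    calc c * (N * A ^ t) ≤ c * (N * (lam * r) ^ t) := by gcongr
      _ = (c * lam ^ t) * (N * r ^ t) := by rw [mul_pow]; ring
      _ ≤ L * (N * r ^ t) := by gcongr
      _ = 1 * 1 * 1 * L * (N * r ^ t) := by ring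
      _ ≤ 2 * L ^ 32 * L ^ (16 * k) * L * (N * r ^ t) := by
        gcongr
        norm_num
      _ = L ^ 33 * (2 * (N * L ^ (16 * k)) * r) * r ^ (t - 1) := by
        have : r ^ t = r * r ^ (t - 1) := by
          rw [← pow_succ', Nat.sub_add_cancel ht]
        rw [this]
        ring

end TripartiteThreeGraph

/-! ### Substituting the original parameters -/

theorem proposition2p2 :
    ∃ C : ℝ, 0 < C ∧ ∀ s t : ℕ, 3 ≤ s → 3 ≤ t → ∃ δ : ℝ, 0 < δ ∧
      ∀ (V : Type*) [Fintype V] [DecidableEq V] (H : TripartiteThreeGraph V) (ℓ K n : ℝ),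
        0 < K → 1 < n →
        -- (a)
        (∀ i, ((H.part i).card : ℝ) ≤ n) →
        -- (b)
        K * n ^ (3 - 3 / (s : ℝ)) * (12 * Real.log n) ^ 16 ≤ (H.edges.card : ℝ) →
        -- (c)
        (∀ i j, i ≠ j →
          (H.m i j : ℝ) ≤ ℓ * ((H.part 0).card : ℝ) ^ (2 - 1 / (s : ℝ))) →
        -- (d)
        δ⁻¹ ≤ ℓ → ℓ ≤ δ * K ^ (((s : ℝ) - 1) / (2 * (s : ℝ) - 3)) →
        -- (e)
        (∀ i j, i ≠ j → ∀ e ∈ H.shadowPairs i j, (H.edgeDegree e : ℝ) ≤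
          K * n ^ (3 - 3 / (s : ℝ)) * (H.m i j : ℝ)⁻¹ * (12 * Real.log n) ^ 32) →
        -- (f)
        (∀ v ∈ H.part 0, (H.degreeInto v 1 : ℝ) ≤
          ℓ * ((H.part 0).card : ℝ) ^ (1 - 1 / (s : ℝ)) * (12 * Real.log n) ^ 16) →
        ∃ 𝒢 : Finset (Finset (Sym2 V)),
          (∀ F ∈ 𝒢, ∃ S T : Finset V, IsKstCopy H.shadowGraph s t S T F ∧
            (S ∩ H.part 0).card = 1 ∧ (S ∩ H.part 1).card = s - 1 ∧ T ⊆ H.part 2) ∧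
          C⁻¹ * Real.log n ^ (-C) * mainCount s t n K ℓ ≤ (𝒢.card : ℝ) ∧
          ∀ σ : Finset (Sym2 V), (σ : Set (Sym2 V)) ⊆ H.shadowGraph.edgeSet →
            ((collectionDegree 𝒢 σ : ℝ) : WithTop ℝ) ≤
              phi H s t n δ K ℓ (edgeVertices σ) := by
  -- The factor 12^34 comes from L^34 = (12 log n)^34; as an exponent it only has to be at least 34,
  -- because log n ≥ 1.
  refine ⟨12 ^ 34, by positivity, fun s t hs ht => ?_⟩
  obtain ⟨k, rfl⟩ : ∃ k, s = k + 1 := ⟨s - 1, by omega⟩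
  set W : ℝ := (absorbConst k t : ℝ) with hW
  have hW2 : 12 ≤ W := by
    have : 12 ≤ absorbConst k t := Nat.le_add_left _ _
    rw [hW]
    exact_mod_cast this
  -- δ is exponentially small in W so that δ⁻¹ ≤ B ≤ 2n forces log n ≥ W; the extra 1 in the
  -- exponent covers the factor 2.
  refine ⟨Real.exp (-(W + 1)), Real.exp_pos _, ?_⟩
  intro V _ _ H ℓ K n hK hn ha hb hc hd1 hd2 he hf
  set δ := Real.exp (-(W + 1)) with hδdef
  have hδ : 0 < δ := Real.exp_pos _
  have hδinv : δ⁻¹ = Real.exp (W + 1) := by rw [hδdef, Real.exp_neg, inv_inv]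
  have hWδ : W ≤ δ⁻¹ := by
    rw [hδinv]
    linarith [Real.add_one_le_exp (W + 1)]
  have hδ1 : δ ≤ 1 := Real.exp_le_one_iff.2 (by linarith)
  set s : ℝ := ((k + 1 : ℕ) : ℝ) with hsdef
  have hsk : s = k + 1 := by rw [hsdef]; push_cast; ring
  have hs3 : 3 ≤ s := by rw [hsdef]; exact_mod_cast hs
  have hs0 : 0 < s := by linarith
  have hn0 : 0 < n := by linarith
  have hℓ0 : 0 < ℓ := (inv_pos.2 hδ).trans_le hd1
  have hlog : 0 < Real.log n := Real.log_pos hn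
  have hinv3 : 1 / s ≤ 1 / 3 := one_div_le_one_div_of_le (by norm_num) hs3
  have hinv0 : 0 < 1 / s := by positivity
  have h2s : 2 / s = 2 * (1 / s) := by ring
  obtain ⟨id1, id2, id3⟩ := rpow_identities hℓ0 hK hn0 hsk
  obtain ⟨hA, hB⟩ := inv_le_of_le_mul_rpow hs3 hδ hδ1 hK hd1 hd2
  have hnpow : 1 ≤ n ^ (1 - 2 / s) := Real.one_le_rpow hn.le (by linarith)
  have hB' : δ⁻¹ ≤ ℓ⁻¹ * K * n ^ (1 - 2 / s) :=
    hB.trans (le_mul_of_one_le_right (by positivity) hnpow)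
  have hcard0 : (0 : ℝ) ≤ (H.part 0).card := Nat.cast_nonneg _
  have hm : ∀ i j, i ≠ j → (H.m i j : ℝ) ≤ ℓ * n ^ (2 - 1 / s) := fun i j hij =>
    (hc i j hij).trans (mul_le_mul_of_nonneg_left
      (Real.rpow_le_rpow hcard0 (ha 0) (by linarith)) hℓ0.le)
  have hmain := H.exists_collection_of_density k t (by omega) (by omega)
    (A := ℓ ^ (3 - 2 * s) * K ^ (s - 1)) (B := ℓ⁻¹ * K * n ^ (1 - 2 / s))
    (U := ℓ * n ^ (2 - 1 / s)) (N := ℓ ^ (s - 1) * n ^ (s - 1 + 1 / s))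
    (L := 12 * Real.log n)
    (Λ := ℓ * ((H.part 0).card : ℝ) ^ (1 - 1 / s) * (12 * Real.log n) ^ 16) (δ := δ) (n := n)
    hδ ?_ hA hB' (by positivity) (by positivity) id2 (by positivity) (ha 1) ?_ ?_
    (hm 0 2 (by decide)) (hm 1 2 (by decide)) ?_ hf ?_
  · obtain ⟨𝒢, h1, h2, hL1, h3⟩ := hmain
    rw [← hW] at hL1
    refine ⟨𝒢, h1, ?_, ?_⟩
    · have hlog1 : 1 ≤ Real.log n := by linarith
      have hlogpow : Real.log n ^ (-(12 ^ 34) : ℝ) ≤ (Real.log n ^ 34)⁻¹ := by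
        rw [← Real.rpow_ofNat (Real.log n) 34, ← Real.rpow_neg hlog.le]
        exact Real.rpow_le_rpow_of_exponent_le hlog1 (by norm_num)
      have hMeq : mainCount (k + 1) t n K ℓ = ℓ ^ (s - 1) * n ^ (s - 1 + 1 / s) *
          (ℓ ^ (3 - 2 * s) * K ^ (s - 1)) ^ t := rfl
      have hM0 : 0 ≤ mainCount (k + 1) t n K ℓ := by rw [hMeq]; positivity
      rw [← hMeq] at h2
      calc _ ≤ ((12 : ℝ) ^ 34)⁻¹ * (Real.log n ^ 34)⁻¹ * mainCount (k + 1) t n K ℓ := by gcongr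
        _ ≤ ((12 : ℝ) ^ 34)⁻¹ * (Real.log n ^ 34)⁻¹ * ((12 * Real.log n) ^ 34 * 𝒢.card) := by gcongr
        _ = 𝒢.card := by
          rw [mul_pow]
          field_simp
    · intro σ _
      have hphi : ∀ ν : Finset V, phi H (k + 1) t n δ K ℓ ν =
          if (ν ∩ (H.part 0 ∪ H.part 1)).card = 0 ∨ (ν ∩ H.part 2).card = 0 then ⊤
          else ((H.phiValue (mainCount (k + 1) t n K ℓ) (ℓ ^ (3 - 2 * s) * K ^ (s - 1))
            (ℓ⁻¹ * K * n ^ (1 - 2 / s)) δ ν : ℝ) : WithTop ℝ) := by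
        intro ν
        simp only [phi, TripartiteThreeGraph.phiValue, ← hsdef, mul_assoc]
      rw [hphi]
      split_ifs with h0
      · exact le_top
      · obtain ⟨h0a, h0b⟩ := not_or.1 h0
        rw [WithTop.coe_le_coe]
        rcases h3 σ h0a h0b with hzero | hle
        · rw [hzero, Nat.cast_zero]
          unfold TripartiteThreeGraph.phiValue mainCount
          positivity
        · exact hle
  · rw [← hW, ← le_div_iff₀' hδ, one_div]
    exact hWδ
  · intro hBn
    have h4 : Real.exp W ≤ n := by
      have h5 : Real.exp W * 2 ≤ Real.exp (W + 1) := by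
        rw [Real.exp_add]
        have := Real.add_one_le_exp (1 : ℝ)
        gcongr
        linarith
      rw [hδinv] at hB'
      linarith
    have h6 : W ≤ Real.log n := (Real.le_log_iff_exp_le hn0).2 h4
    linarith
  · rw [← id1]
    exact hb
  · intro i j hij e hmem
    rw [← id1]
    exact he i j hij e hmem
  · have hpow : ((H.part 0).card : ℝ) ^ (1 - 1 / s) ≤ n ^ (1 - 1 / s) :=
      Real.rpow_le_rpow hcard0 (ha 0) (by linarith)
    have h0 : 0 ≤ ((H.part 0).card : ℝ) ^ (1 - 1 / s) := Real.rpow_nonneg hcard0 _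
    calc ((H.part 0).card : ℝ) *
          (ℓ * ((H.part 0).card : ℝ) ^ (1 - 1 / s) * (12 * Real.log n) ^ 16) ^ k
        ≤ n * (ℓ * n ^ (1 - 1 / s) * (12 * Real.log n) ^ 16) ^ k := by
          have := ha 0
          gcongr
      _ = _ := by
          rw [mul_pow, ← pow_mul, ← mul_assoc, id3]
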